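/- Let $s\ge 1$ and let $h,v\in\mathrm{Sym}(s)$ generate a group that acts transitively on $[s]=\{1,\dots,s\}$. The origami $X(h,v)$ is the surface obtained from $[0,1]^2\times[s]$ by the identifications $(1,y,j)\sim(0,y,h(j))$ and $(x,1,j)\sim(x,0,v(j))$. A horizontal (respectively vertical) cylinder core curve is a simple closed curve on $X(h,v)$ all of whose points are of the form $(x,\tfrac12,j)$ (respectively $(\tfrac12,y,j)$); let $\mathcal N(h,v)$ be the set of all cylinder core curves. $X(h,v)$ is geometrically simple if the geometric intersection number $i(\eta,\eta')$, that is, the minimal number of intersection points of a curve isotopic to $\eta$ with a curve isotopic to $\eta'$, is at most $1$ for all $\eta,\eta'\in\mathcal N(h,v)$. It is arboreal if the simple graph with vertex set $\mathcal N(h,v)$, in which two distinct core curves are adjacent if and only if they intersect, is a tree. The standard triangulation $\tau(h,v)$ is the one whose faces are the two triangles into which the positively sloped diagonal cuts each square of $X(h,v)$. Let $\Gamma$ be its dual graph: its vertices are the edges $e$ and the faces $f$ of $\tau(h,v)$, and it has one edge (half-edge) $(f,e)$, directed from $f$ to $e$, whenever $e$ is a side of $f$. The group $\mathbb Z/3\mathbb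 Z$ acts on the set $H$ of half-edges by cyclically permuting the three sides of each face counterclockwise. Let $C_1(\Gamma)=\mathbb Z\langle H\rangle$ and let $H_1(\Gamma)\le C_1(\Gamma)$ be the kernel of $\partial(f,e)=e-f$. A triangle matching is a bijection $\iota:H\to H$ that commutes with the action of $\mathbb Z/3\mathbb Z$ and whose induced automorphism of $C_1(\Gamma)$ satisfies $\iota(\alpha)=-\alpha$ for all $\alpha\in H_1(\Gamma)$. Theorem. Suppose that the origami $X(h,v)$ is geometrically simple. Then the following are equivalent: (i) $X(h,v)$ is arboreal; (ii) $\tau(h,v)$ admits a triangle matching; (iii) $\#\mathrm{cycles}(h)+\#\mathrm{cycles}(v)=s+1$, where $\#\mathrm{cycles}(\sigma)$ is the number of cycles of $\sigma\in\mathrm{Sym}(s)$, fixed points counted as cycles. -/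

import Mathlib

/-! ### Curves on a topological space and geometric intersection numbers -/

/-- A simple closed curve: the image of the circle under a continuous injective map. -/
def IsSimpleClosedCurve {Y : Type*} [TopologicalSpace Y] (β : Set Y) : Prop :=
  ∃ γ : Circle → Y, Continuous γ ∧ Function.Injective γ ∧ Set.range γ = β

/-- `a'` is isotopic to `a`: there is an ambient isotopy carrying `a` to `a'`. -/
def IsIsotopic {Y : Type*} [TopologicalSpace Y] (a a' : Set Y) : Prop :=
  ∃ F : unitInterval → Y ≃ₜ Y, Continuous (fun p : unitInterval × Y => F p.1 p.2) ∧
    F 0 = Homeomorph.refl Y ∧ F 1 '' a = a'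

/-- The geometric intersection number `i(a, b)`: the least number of points of `a' ∩ b'`,
where `a'` and `b'` range over the isotopy classes of `a` and `b`. -/
noncomputable def geometricIntersection {Y : Type*} [TopologicalSpace Y] (a b : Set Y) : ℕ∞ :=
  ⨅ (a' : Set Y) (_ : IsIsotopic a a') (b' : Set Y) (_ : IsIsotopic b b'), (a' ∩ b').encard

/-! ### Trivalent ribbon graphs and triangle matchings -/

/-- A trivalent ribbon graph: a graph with vertex set `E ⊔ F` and edge set `H` (the half-edges),
each half-edge `x` joining `φ x : F` to `ε x : E`, where the vertices in `E` have valence 2 and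
those in `F` have valence 3, with a fixed-point-free action of `ℤ/3` on the fibres of `φ`, given
by the action `rot` of its generator: if `x = (f, e)`, then `rot x = (f, e + 1)`. -/
structure TrivalentRibbonGraph where
  E : Type
  F : Type
  H : Type
  finite_E : Finite E
  finite_F : Finite F
  ε : H → E
  φ : H → F
  card_ε : ∀ e, Nat.card {x // ε x = e} = 2
  card_φ : ∀ f, Nat.card {x // φ x = f} = 3
  rot : Equiv.Perm H
  φ_rot : ∀ x, φ (rot x) = φ x
  rot_rot_rot : ∀ x, rot (rot (rot x)) = x
  rot_ne : ∀ x, rot x ≠ x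

namespace TrivalentRibbonGraph

variable (Γ : TrivalentRibbonGraph)

/-- The boundary map `C₁(Γ) → C₀(Γ)`, `∂(f, e) = e - f`. -/
noncomputable def boundary : (Γ.H →₀ ℤ) →ₗ[ℤ] ((Γ.E ⊕ Γ.F) →₀ ℤ) :=
  Finsupp.linearCombination ℤ fun x =>
    Finsupp.single (Sum.inl (Γ.ε x)) 1 - Finsupp.single (Sum.inr (Γ.φ x)) 1

/-- `H₁(Γ)`, which is the group of 1-cycles because `Γ` is 1-dimensional. -/
noncomputable def homology : Submodule ℤ (Γ.H →₀ ℤ) := LinearMap.ker Γ.boundary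

/-- A triangle matching: a bijection of the half-edges that commutes with the `ℤ/3`-action and
whose induced automorphism of `C₁(Γ)` is `-1` on `H₁(Γ)`. -/
def IsTriangleMatching (ι : Equiv.Perm Γ.H) : Prop :=
  (∀ x, ι (Γ.rot x) = Γ.rot (ι x)) ∧
    ∀ α ∈ Γ.homology, Finsupp.mapDomain ι α = -α

end TrivalentRibbonGraph

/-! ### Origamis -/

namespace Origami

variable {s : ℕ}

/-- The disjoint union `[0,1]² × [s]` of `s` unit squares. -/
abbrev Squares (s : ℕ) : Type := (unitInterval × unitInterval) × Fin s

/-- The gluing relations `(1, y, j) ∼ (0, y, h j)` and `(x, 1, j) ∼ (x, 0, v j)`. -/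
inductive Glue (h v : Equiv.Perm (Fin s)) : Squares s → Squares s → Prop
  | right (y : unitInterval) (j : Fin s) : Glue h v ((1, y), j) ((0, y), h j)
  | top (x : unitInterval) (j : Fin s) : Glue h v ((x, 1), j) ((x, 0), v j)

/-- The surface `X(h, v)`: the quotient of the squares by the equivalence relation generated by
the gluing relations, with the quotient topology. -/
def Surface (h v : Equiv.Perm (Fin s)) : Type := Quot (Glue h v)

instance (h v : Equiv.Perm (Fin s)) : TopologicalSpace (Surface h v) :=
  inferInstanceAs (TopologicalSpace (Quot (Glue h v)))

/-- The quotient map from the squares onto the surface. -/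
def proj (h v : Equiv.Perm (Fin s)) : Squares s → Surface h v := Quot.mk (Glue h v)

/-- `(h, v)` defines an origami: there is at least one square, and the group generated by `h` and
`v` acts transitively on the squares. -/
def IsOrigami (h v : Equiv.Perm (Fin s)) : Prop :=
  0 < s ∧ MulAction.IsPretransitive (Subgroup.closure {h, v}) (Fin s)

/-- The midpoint of the unit interval. -/
noncomputable def half : unitInterval := ⟨1 / 2, by norm_num, by norm_num⟩

/-- Horizontal cylinder core curves: simple closed curves all of whose points are of the form
`(x, 1/2, j)`. -/
def IsHorizontalCore (h v : Equiv.Perm (Fin s)) (β : Set (Surface h v)) : Prop :=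
  IsSimpleClosedCurve β ∧ ∀ z ∈ β, ∃ x j, z = proj h v ((x, half), j)

/-- Vertical cylinder core curves: simple closed curves all of whose points are of the form
`(1/2, y, j)`. -/
def IsVerticalCore (h v : Equiv.Perm (Fin s)) (β : Set (Surface h v)) : Prop :=
  IsSimpleClosedCurve β ∧ ∀ z ∈ β, ∃ y j, z = proj h v ((half, y), j)

/-- The network `𝒩(h, v)` of all cylinder core curves. -/
def network (h v : Equiv.Perm (Fin s)) : Set (Set (Surface h v)) :=
  {β | IsHorizontalCore h v β ∨ IsVerticalCore h v β}

/-- Geometrically simple origamis. -/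
def IsGeometricallySimple (h v : Equiv.Perm (Fin s)) : Prop :=
  ∀ η ∈ network h v, ∀ η' ∈ network h v, geometricIntersection η η' ≤ 1

/-- The intersection graph of the core curves. -/
def intersectionGraph (h v : Equiv.Perm (Fin s)) : SimpleGraph (network h v) where
  Adj η η' := η ≠ η' ∧ (η.1 ∩ η'.1).Nonempty
  symm := ⟨fun η η' hη => ⟨hη.1.symm, by rw [Set.inter_comm]; exact hη.2⟩⟩
  loopless := ⟨fun _ hη => hη.1 rfl⟩

/-- An origami is arboreal if the intersection graph of its core curves is a tree. -/
def IsArboreal (h v : Equiv.Perm (Fin s)) : Prop := (intersectionGraph h v).IsTree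

/-- The number of cycles of a permutation, fixed points included. -/
noncomputable def numCycles (σ : Equiv.Perm (Fin s)) : ℕ :=
  Nat.card (Quotient (Equiv.Perm.SameCycle.setoid σ))

/-! ### The standard triangulation -/

/-- The positively sloped diagonal cuts the unit square into a triangle below it (`false`) and a
triangle above it (`true`). These are the corners of the two triangles, in counterclockwise
order. -/
def corner : Bool → Fin 3 → ℝ × ℝ
  | false => ![(0, 0), (1, 0), (1, 1)]
  | true => ![(0, 0), (1, 1), (0, 1)]

/-- The faces of the standard triangulation: two triangles in every square. -/
abbrev Face (s : ℕ) : Type := Fin s × Bool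

/-- The half-edges of the standard triangulation. `(f, i)` is the side of the face `f` that runs
from its corner `i` to its corner `i + 1`; the successor of this side in the counterclockwise
order is `(f, i + 1)`, where `i : Fin 3` is read modulo 3. -/
abbrev HalfEdge (s : ℕ) : Type := Face s × Fin 3

/-- The points of the squares that lie on a given side of a given triangle. -/
def sidePoints (x : HalfEdge s) : Set (Squares s) :=
  {p | p.2 = x.1.1 ∧
    ((p.1.1 : ℝ), (p.1.2 : ℝ)) ∈ segment ℝ (corner x.1.2 x.2) (corner x.1.2 (x.2 + 1))}

/-- The edge, as a subset of the surface, that a given side of a given triangle becomes. -/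
def side (h v : Equiv.Perm (Fin s)) (x : HalfEdge s) : Set (Surface h v) :=
  proj h v '' sidePoints x

/-- A combinatorial name for the edge to which a half-edge belongs: `(j, 0)`, `(j, 1)` and
`(j, 2)` stand for the bottom, the left side and the diagonal of the square `j`. -/
def label (h v : Equiv.Perm (Fin s)) : HalfEdge s → Fin s × Fin 3
  | ((j, false), i) => ![(j, 0), (h j, 1), (j, 2)] i
  | ((j, true), i) => ![(j, 2), (v j, 0), (j, 1)] i

theorem mem_sidePoints (x : HalfEdge s) (p : Squares s) :
    p ∈ sidePoints x ↔ p.2 = x.1.1 ∧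
      match x.1.2, x.2 with
      | false, 0 => p.1.2 = 0
      | false, 1 => p.1.1 = 1
      | false, 2 => p.1.1 = p.1.2
      | true, 0 => p.1.1 = p.1.2
      | true, 1 => p.1.2 = 1
      | true, 2 => p.1.1 = 0 := by
  obtain ⟨⟨j, b⟩, i⟩ := x
  obtain ⟨⟨⟨a, ha0, ha1⟩, ⟨c, hc0, hc1⟩⟩, k⟩ := p
  refine and_congr_right fun _ => ?_
  rw [segment_eq_image']
  cases b <;> fin_cases i <;>
    simp [corner, Prod.ext_iff, Subtype.ext_iff] <;>
    first
    | grind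
    | (constructor
       · rintro ⟨t, ⟨_, _⟩, _, _⟩; linarith
       · rintro rfl
         first
         | exact ⟨a, by grind⟩
         | exact ⟨c, by grind⟩
         | exact ⟨1 - a, by grind⟩
         | exact ⟨1 - c, by grind⟩)

/-- The label of the edge of which a point is the midpoint. -/
noncomputable def pointLabel (h v : Equiv.Perm (Fin s)) (p : Squares s) : Option (Fin s × Fin 3) :=
  open Classical in
  if p.1 = (half, 0) then some (p.2, 0)
  else if p.1 = (half, 1) then some (v p.2, 0)
  else if p.1 = (0, half) then some (p.2, 1)
  else if p.1 = (1, half) then some (h p.2, 1)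
  else if p.1 = (half, half) then some (p.2, 2)
  else none

theorem half_ne_zero : half ≠ 0 := by simp [half, Subtype.ext_iff]

theorem half_ne_one : half ≠ 1 := by
  simp only [half, ne_eq, Subtype.ext_iff, Set.Icc.coe_one]; norm_num

theorem pointLabel_glue (h v : Equiv.Perm (Fin s)) {p q : Squares s} (hpq : Glue h v p q) :
    pointLabel h v p = pointLabel h v q := by
  have h0 := half_ne_zero
  have h1 := half_ne_one
  have h2 : (0 : unitInterval) ≠ 1 := zero_ne_one
  cases hpq <;> simp only [pointLabel, Prod.mk.injEq] <;> grind

theorem exists_midpoint (h v : Equiv.Perm (Fin s)) (x : HalfEdge s) :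
    ∃ p ∈ sidePoints x, pointLabel h v p = some (label h v x) := by
  have h0 := half_ne_zero
  have h1 := half_ne_one
  have h2 : (0 : unitInterval) ≠ 1 := zero_ne_one
  obtain ⟨⟨j, b⟩, i⟩ := x
  refine ⟨((match b, i with
      | false, 0 => (half, 0)
      | false, 1 => (1, half)
      | false, 2 => (half, half)
      | true, 0 => (half, half)
      | true, 1 => (half, 1)
      | true, 2 => (0, half)), j), ?_, ?_⟩
  · rw [mem_sidePoints]
    cases b <;> fin_cases i <;> simp
  · cases b <;> fin_cases i <;> simp [pointLabel, label, h0, h1, h0.symm, h1.symm]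

theorem pointLabel_of_mem (h v : Equiv.Perm (Fin s)) (x : HalfEdge s) (p : Squares s)
    (hp : p ∈ sidePoints x) (l : Fin s × Fin 3) (hl : pointLabel h v p = some l) :
    l = label h v x := by
  have h0 := half_ne_zero
  have h1 := half_ne_one
  have h2 : (0 : unitInterval) ≠ 1 := zero_ne_one
  rw [mem_sidePoints] at hp
  obtain ⟨⟨j, b⟩, i⟩ := x
  obtain ⟨⟨a, c⟩, k⟩ := p
  simp only [pointLabel, Prod.mk.injEq] at hl
  cases b <;> fin_cases i <;> simp [label] at hp ⊢ <;> grind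

theorem side_eq_of_label (h v : Equiv.Perm (Fin s)) (x : HalfEdge s) :
    side h v x = match label h v x with
      | (j, 0) => side h v ((j, false), 0)
      | (j, 1) => side h v ((j, true), 2)
      | (j, 2) => side h v ((j, false), 2) := by
  have hr (y j) : proj h v ((1, y), j) = proj h v ((0, y), h j) := Quot.sound (.right y j)
  have ht (y j) : proj h v ((y, 1), j) = proj h v ((y, 0), v j) := Quot.sound (.top y j)
  obtain ⟨⟨j, b⟩, i⟩ := x
  cases b <;> fin_cases i <;> simp only [label] <;> ext z <;>
    simp [side, mem_sidePoints, hr, ht]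

theorem side_eq_iff (h v : Equiv.Perm (Fin s)) (x y : HalfEdge s) :
    side h v x = side h v y ↔ label h v x = label h v y := by
  constructor
  · intro hxy
    obtain ⟨p, hp, hl⟩ := exists_midpoint h v x
    have hmem : proj h v p ∈ side h v y := hxy ▸ Set.mem_image_of_mem _ hp
    obtain ⟨q, hq, hqp⟩ := hmem
    have := congrArg (Quot.lift (pointLabel h v) fun _ _ => pointLabel_glue h v) hqp
    exact pointLabel_of_mem h v y q hq _ ((show pointLabel h v q = pointLabel h v p from this).trans hl)
  · intro hxy
    rw [side_eq_of_label, side_eq_of_label h v y, hxy]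

theorem card_label_fibre (h v : Equiv.Perm (Fin s)) (l : Fin s × Fin 3) :
    Nat.card {x : HalfEdge s // label h v x = l} = 2 := by
  have key : ∃ x y : HalfEdge s, x ≠ y ∧ {z | label h v z = l} = {x, y} := by
    obtain ⟨j, k⟩ := l
    refine ⟨match k with
      | 0 => ((j, false), 0)
      | 1 => ((h.symm j, false), 1)
      | 2 => ((j, false), 2), match k with
      | 0 => ((v.symm j, true), 1)
      | 1 => ((j, true), 2)
      | 2 => ((j, true), 0), ?_, ?_⟩
    · fin_cases k <;> simp
    · ext ⟨⟨i, b⟩, n⟩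
      cases b <;> fin_cases k <;> fin_cases n <;> simp [label, Equiv.eq_symm_apply]
  obtain ⟨x, y, hne, heq⟩ := key
  exact (congrArg Set.ncard heq).trans (Set.ncard_pair hne)

/-- Every half-edge is determined by its face and by its edge. -/
theorem halfEdge_ext (h v : Equiv.Perm (Fin s)) {x y : HalfEdge s} (hF : x.1 = y.1)
    (hE : side h v x = side h v y) : x = y := by
  rw [side_eq_iff] at hE
  obtain ⟨⟨j, b⟩, i⟩ := x
  obtain ⟨⟨j', b'⟩, i'⟩ := y
  obtain ⟨rfl, rfl⟩ := Prod.mk.inj hF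
  cases b <;> fin_cases i <;> fin_cases i' <;> simp_all [label]

/-- The trivalent ribbon graph `Γ(τ(h, v))` dual to the standard triangulation of `X(h, v)`: its
vertices are the edges (as subsets of the surface) and the faces of the triangulation, and its
half-edges are the incident pairs of a face and an edge, with their counterclockwise order. -/
def standardDualGraph (h v : Equiv.Perm (Fin s)) : TrivalentRibbonGraph where
  E := Set.range (side h v)
  F := Face s
  H := HalfEdge s
  finite_E := inferInstance
  finite_F := inferInstance
  ε x := ⟨side h v x, x, rfl⟩
  φ x := x.1
  card_ε := by
    rintro ⟨_, x, rfl⟩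
    refine (Nat.card_congr (Equiv.subtypeEquivRight fun y => ?_)).trans
      (card_label_fibre h v (label h v x))
    exact Subtype.ext_iff.trans (side_eq_iff h v y x)
  card_φ f := by
    rw [← Nat.card_congr (Equiv.ofBijective (fun i : Fin 3 => ⟨(f, i), rfl⟩) ⟨?_, ?_⟩)]
    · simp
    · intro i i' hi
      simpa using hi
    · rintro ⟨⟨_, i⟩, rfl⟩
      exact ⟨i, rfl⟩
  rot := (Equiv.refl _).prodCongr (Equiv.addRight 1)
  φ_rot _ := rfl
  rot_rot_rot := by
    rintro ⟨f, i⟩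
    exact Prod.ext rfl ((by decide : ∀ i : Fin 3, i + 1 + 1 + 1 = i) i)
  rot_ne := by
    rintro ⟨f, i⟩
    fin_cases i <;> simp

/-- The standard triangulation `τ(h, v)` admits a triangle matching. -/
def AdmitsTriangleMatching (h v : Equiv.Perm (Fin s)) : Prop :=
  ∃ ι : Equiv.Perm (standardDualGraph h v).H, (standardDualGraph h v).IsTriangleMatching ι

end Origami

/-! Geometric simplicity enters only through one combinatorial consequence,
`IsGeometricallySimple.eq_of_sameCycle`: a cycle of `h` and a cycle of `v` share at most one square.
The reason is a winding number. Sending a vertical cylinder to `ℝ/ℤ` by its abscissa, and everything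
outside it to `0`, makes the vertical core curve the fibre over `1/2`, and a horizontal core curve
winds around `ℝ/ℤ` once for every square that it shares with the cylinder. Winding is homotopy
invariant, so two common squares force two intersection points for all isotopic representatives
(`two_le_geometricIntersection`).

(i) ⇔ (iii): the vertices of the intersection graph are the cycles of `h` and of `v`, and its edges
are now the squares. Transitivity makes it connected, and a finite connected graph is a tree if and
only if it has one more vertex than edges (`isArboreal_iff`).

(ii) ⇔ (iii): a 1-cycle of the dual graph is determined by its coefficients `l` and `b` on the left
and bottom sides of the squares, subject to the equation `l ∘ h - l + b ∘ v - b = 0`. By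
transitivity this system has rank `s - 1`, so its rational solution space has dimension `s + 1`. The
cylinder classes, where `l` is `h`-invariant and `b` is `v`-invariant, form a subspace of dimension
`numCycles h + numCycles v`. Hence (iii) says that there are no other solutions
(`numCycles_add_eq_iff`). In that case the half-turn of every square negates all 1-cycles.
Conversely, testing a matching on the two cylinder classes through a square `j` shows that it sends
the bottom of `j` to the top of a square in both cycles, which must be `j`; negation of an arbitrary
1-cycle then says that `l` and `b` are invariant. -/

/-! ### Maps of the circle and intersection numbers -/

/-- A continuous real function on the circle takes the same value at some pair of antipodes. -/
theorem Circle.exists_apply_eq_apply_neg {f : Circle → ℝ} (hf : Continuous f) :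
    ∃ z : Circle, f z = f (-z) := by
  have hc : Continuous fun z : Circle => f z - f (-z) := by fun_prop
  have h0 : (0 : ℝ) ∈ Set.range fun z : Circle => f z - f (-z) := by
    rcases le_total (f 1) (f (-1)) with hle | hle
    · exact mem_range_of_exists_le_of_exists_ge hc ⟨1, by simpa using hle⟩
        ⟨-1, by simpa using hle⟩
    · exact mem_range_of_exists_le_of_exists_ge hc ⟨-1, by simpa using hle⟩
        ⟨1, by simpa using hle⟩
  obtain ⟨z, hz⟩ := h0
  exact ⟨z, sub_eq_zero.1 hz⟩

/-- A continuous injective map from the circle to itself is surjective. -/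
theorem Circle.surjective_of_continuous_of_injective {f : Circle → Circle} (hf : Continuous f)
    (hinj : Function.Injective f) : Function.Surjective f := by
  by_contra hns
  obtain ⟨w, hw⟩ := not_forall.1 hns
  -- Rotating the omitted value `w` to `-1`, the cut of `arg`, turns `f` into a continuous injective
  -- real function on the circle, which cannot exist because some antipodes have equal values.
  have hne (z : Circle) : ((-(f z / w) : Circle) : ℂ) ∈ Complex.slitPlane := by
    rw [Complex.mem_slitPlane_iff_arg]
    refine ⟨fun harg => hw ⟨z, ?_⟩, Circle.coe_ne_zero _⟩
    have h1 : (-(f z / w) : Circle) = -1 := by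
      rw [← Circle.injective_arg.eq_iff, harg]
      simp
    rw [neg_inj, div_eq_one] at h1
    exact h1
  have hc : Continuous fun z : Circle => Complex.arg ((-(f z / w) : Circle) : ℂ) := by
    rw [continuous_iff_continuousAt]
    intro z
    refine (Complex.continuousAt_arg (hne z)).comp_of_eq ?_ rfl
    exact (by fun_prop : Continuous fun z : Circle => ((-(f z / w) : Circle) : ℂ)).continuousAt
  obtain ⟨z, hz⟩ := Circle.exists_apply_eq_apply_neg hc
  have h2 := Circle.injective_arg hz
  rw [neg_inj, div_left_inj] at h2
  have h3 := congrArg (Subtype.val) (hinj h2)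
  have h4 : (z : ℂ) = -z := h3
  exact Circle.coe_ne_zero z (self_eq_neg.1 h4)

/-! ### Winding numbers of loops and a lower bound for intersection numbers. -/

theorem UnitAddCircle.coe_eq_coe_iff {a b : ℝ} :
    (a : UnitAddCircle) = b ↔ ∃ n : ℤ, b = a + n := by
  rw [eq_comm, ← sub_eq_zero, ← AddCircle.coe_sub, AddCircle.coe_eq_zero_iff]
  exact exists_congr fun n => by rw [zsmul_one, eq_comm, sub_eq_iff_eq_add']

/-- The total increment of a lift to `ℝ` of a loop in `ℝ/ℤ` is a homotopy invariant. -/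
theorem UnitAddCircle.exists_lift_of_homotopy {K : unitInterval × unitInterval → UnitAddCircle}
    (hK : Continuous K) (hloop : ∀ t, K (t, 0) = K (t, 1)) {L : unitInterval → ℝ}
    (hL : Continuous L) (hKL : ∀ x, K (0, x) = L x) :
    ∃ L' : unitInterval → ℝ, Continuous L' ∧ (∀ x, K (1, x) = L' x) ∧
      L' 1 - L' 0 = L 1 - L 0 := by
  have cov : IsCoveringMap ((↑) : ℝ → UnitAddCircle) := AddCircle.isCoveringMap_coe 1
  let N := cov.liftHomotopy ⟨K, hK⟩ ⟨L, hL⟩ (by intro x; exact hKL x)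
  have hN (q) : ((N q : ℝ) : UnitAddCircle) = K q :=
    congrFun (cov.liftHomotopy_lifts ⟨K, hK⟩ ⟨L, hL⟩ (by intro x; exact hKL x)) q
  have hN0 (x) : N (0, x) = L x :=
    cov.liftHomotopy_zero ⟨K, hK⟩ ⟨L, hL⟩ (by intro x; exact hKL x) x
  -- The increment of the lifted loop is an integer that varies continuously with `t`, hence is
  -- constant.
  have hint (t : unitInterval) : ∃ n : ℤ, N (t, 1) - N (t, 0) = n := by
    have := (hN (t, 0)).trans ((hloop t).trans (hN (t, 1)).symm)
    obtain ⟨n, hn⟩ := UnitAddCircle.coe_eq_coe_iff.1 this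
    exact ⟨n, by linarith⟩
  choose n hn using hint
  have hncont : Continuous n := by
    rw [Int.isClosedEmbedding_coe_real.isEmbedding.continuous_iff]
    have : ((↑) : ℤ → ℝ) ∘ n = fun t => N (t, 1) - N (t, 0) := funext fun t => (hn t).symm
    rw [this]
    fun_prop
  have hconst : n 1 = n 0 := PreconnectedSpace.constant inferInstance hncont
  refine ⟨fun x => N (1, x), by fun_prop, fun x => (hN (1, x)).symm, ?_⟩
  have h0 := hn 0
  have h1 := hn 1
  rw [hN0, hN0] at h0
  rw [h0, h1, hconst]

/-- A path in `ℝ` whose increment is at least `2` meets `1/2 + ℤ` at two parameters before its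
end. -/
theorem exists_two_eq_half {L : unitInterval → ℝ} (hL : Continuous L) (h2 : 2 ≤ L 1 - L 0) :
    ∃ t t' : unitInterval, t ≠ t' ∧ t ≠ 1 ∧ t' ≠ 1 ∧
      (L t : UnitAddCircle) = ((1 / 2 : ℝ) : UnitAddCircle) ∧
      (L t' : UnitAddCircle) = ((1 / 2 : ℝ) : UnitAddCircle) := by
  have key (m : ℤ) (h0 : L 0 ≤ m + 1 / 2) (h1 : (m : ℝ) + 1 / 2 < L 1) :
      ∃ t : unitInterval, t ≠ 1 ∧ L t = m + 1 / 2 := by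
    obtain ⟨t, ht⟩ := mem_range_of_exists_le_of_exists_ge hL ⟨0, h0⟩ ⟨1, h1.le⟩
    refine ⟨t, ?_, ht⟩
    rintro rfl
    exact h1.ne ht.symm
  -- The two values are the least half-integer (element of `1/2 + ℤ`) that is at least `L 0`, and
  -- its successor. The successor is below `L 0 + 2 ≤ L 1`, so neither value is attained at the end
  -- point.
  have ha := Int.le_ceil (L 0 - 1 / 2)
  have hb := Int.ceil_lt_add_one (L 0 - 1 / 2)
  obtain ⟨t, ht1, ht⟩ := key ⌈L 0 - 1 / 2⌉ (by linarith) (by linarith)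
  obtain ⟨t', ht1', ht'⟩ := key (⌈L 0 - 1 / 2⌉ + 1) (by push_cast; linarith)
    (by push_cast; linarith)
  refine ⟨t, t', ?_, ht1, ht1', ?_, ?_⟩
  · rintro rfl
    rw [ht] at ht'
    push_cast at ht'
    linarith
  · exact UnitAddCircle.coe_eq_coe_iff.2 ⟨-⌈L 0 - 1 / 2⌉, by rw [ht]; push_cast; ring⟩
  · exact UnitAddCircle.coe_eq_coe_iff.2 ⟨-(⌈L 0 - 1 / 2⌉ + 1), by rw [ht']; push_cast; ring⟩

/-- If a map `p : Y → ℝ/ℤ` winds at least twice along a simple loop, then this loop has geometric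
intersection number at least `2` with the fibre `p⁻¹(1/2)`. -/
theorem two_le_geometricIntersection {Y : Type*} [TopologicalSpace Y] {p : Y → UnitAddCircle}
    (hp : Continuous p) {γ : unitInterval → Y} (hγ : Continuous γ) (hloop : γ 0 = γ 1)
    (hinj : Set.InjOn γ {1}ᶜ) {L : unitInterval → ℝ} (hL : Continuous L)
    (hpL : ∀ x, p (γ x) = L x) (h2 : 2 ≤ L 1 - L 0) :
    2 ≤ geometricIntersection (Set.range γ) (p ⁻¹' {((1 / 2 : ℝ) : UnitAddCircle)}) := by
  refine le_iInf₂ fun a' ⟨F, hF, hF0, ha'⟩ => le_iInf₂ fun b' ⟨G, hG, hG0, hb'⟩ => ?_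
  -- The set `b'` is the fibre over `1/2` of `p ∘ (G 1)⁻¹`. Running `G` backwards deforms `p ∘ γ` to
  -- `p ∘ (G 1)⁻¹ ∘ γ`, and running `F` then deforms this to `p ∘ (G 1)⁻¹ ∘ F 1 ∘ γ`; the increment
  -- of the lift survives both homotopies.
  have hq : Continuous fun y => p ((G 1).symm y) := hp.comp (G 1).symm.continuous
  have hKG : Continuous fun q : unitInterval × unitInterval =>
      p ((G 1).symm (G (unitInterval.symm q.1) (γ q.2))) :=
    hq.comp (hG.comp (by fun_prop :
      Continuous fun q : unitInterval × unitInterval => (unitInterval.symm q.1, γ q.2)))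
  have hKF : Continuous fun q : unitInterval × unitInterval =>
      p ((G 1).symm (F q.1 (γ q.2))) :=
    hq.comp (hF.comp (by fun_prop :
      Continuous fun q : unitInterval × unitInterval => (q.1, γ q.2)))
  obtain ⟨L₁, hL₁, hL₁', hL₁d⟩ := UnitAddCircle.exists_lift_of_homotopy hKG
    (fun t => by simp only [hloop]) hL (fun x => by simp [hpL])
  obtain ⟨L₂, hL₂, hL₂', hL₂d⟩ := UnitAddCircle.exists_lift_of_homotopy hKF
    (fun t => by simp only [hloop]) hL₁ (fun x => by
      rw [← hL₁']
      simp [hF0, hG0])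
  obtain ⟨t, t', hne, ht1, ht1', ht, ht'⟩ := exists_two_eq_half hL₂ (by linarith)
  rw [← hL₂'] at ht ht'
  have hmem (u : unitInterval)
      (hu : p ((G 1).symm (F 1 (γ u))) = ((1 / 2 : ℝ) : UnitAddCircle)) :
      F 1 (γ u) ∈ a' ∩ b' := by
    refine ⟨ha' ▸ Set.mem_image_of_mem _ (Set.mem_range_self u), hb' ▸ ?_⟩
    exact ⟨(G 1).symm (F 1 (γ u)), hu, by simp⟩
  have hne' : F 1 (γ t) ≠ F 1 (γ t') := fun he => hne (hinj ht1 ht1' ((F 1).injective he))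
  calc (2 : ℕ∞) = ({F 1 (γ t), F 1 (γ t')} : Set Y).encard := (Set.encard_pair hne').symm
    _ ≤ (a' ∩ b').encard := Set.encard_le_encard
      (Set.insert_subset (hmem t ht) (Set.singleton_subset_iff.2 (hmem t' ht')))

/-! ### Horizontal and vertical core curves -/

/-- The covering `ℝ → Circle` with period `n`. -/
noncomputable def Circle.expPeriod (n : ℕ) (t : ℝ) : Circle := Circle.exp (2 * Real.pi * t / n)

theorem Circle.continuous_expPeriod (n : ℕ) : Continuous (Circle.expPeriod n) := by
  unfold Circle.expPeriod
  fun_prop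

theorem Circle.expPeriod_add (n : ℕ) (t t' : ℝ) :
    Circle.expPeriod n (t + t') = Circle.expPeriod n t * Circle.expPeriod n t' := by
  rw [expPeriod, expPeriod, expPeriod, ← Circle.exp_add]
  ring_nf

theorem Circle.expPeriod_eq_iff {n : ℕ} (hn : n ≠ 0) {t t' : ℝ} :
    Circle.expPeriod n t = Circle.expPeriod n t' ↔ ∃ m : ℤ, t = t' + m * n := by
  rw [expPeriod, expPeriod, Circle.exp_eq_exp]
  have hn' : (n : ℝ) ≠ 0 := by exact_mod_cast hn
  have hpi := Real.pi_ne_zero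
  refine exists_congr fun m => ?_
  field_simp

theorem Circle.exists_expPeriod_eq {n : ℕ} (hn : n ≠ 0) (w : Circle) :
    ∃ t : ℝ, Circle.expPeriod n t = w := by
  obtain ⟨u, rfl⟩ : ∃ u, Circle.exp u = w := ⟨_, Circle.exp_arg w⟩
  have hn' : (n : ℝ) ≠ 0 := by exact_mod_cast hn
  refine ⟨u * n / (2 * Real.pi), ?_⟩
  rw [expPeriod]
  congr 1
  have hpi := Real.pi_ne_zero
  field_simp

namespace Origami

variable {s : ℕ}

/-- The length of the cycle of `σ` that contains `j`. -/
noncomputable def period (σ : Equiv.Perm (Fin s)) (j : Fin s) : ℕ := Function.minimalPeriod σ j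

theorem period_ne_zero (σ : Equiv.Perm (Fin s)) (j : Fin s) : period σ j ≠ 0 :=
  (MulAction.minimalPeriod_pos σ j).out

theorem zpow_apply_eq_iff (σ : Equiv.Perm (Fin s)) (j : Fin s) (k l : ℤ) :
    (σ ^ k) j = (σ ^ l) j ↔ (period σ j : ℤ) ∣ k - l := by
  have := MulAction.zpow_smul_eq_iff_minimalPeriod_dvd (a := σ) (b := j) (n := k - l)
  rw [sub_eq_neg_add, zpow_add, zpow_neg, mul_smul, inv_smul_eq_iff, ← sub_eq_neg_add] at this
  exact this

theorem proj_one_left (h v : Equiv.Perm (Fin s)) (y : unitInterval) (j : Fin s) :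
    proj h v ((1, y), j) = proj h v ((0, y), h j) := Quot.sound (.right y j)

theorem proj_one_right (h v : Equiv.Perm (Fin s)) (x : unitInterval) (j : Fin s) :
    proj h v ((x, 1), j) = proj h v ((x, 0), v j) := Quot.sound (.top x j)

theorem continuous_proj (h v : Equiv.Perm (Fin s)) : Continuous (proj h v) := continuous_quot_mk

/-- The horizontal core curve through the square `i`. -/
def horizontalCore (h v : Equiv.Perm (Fin s)) (i : Fin s) : Set (Surface h v) :=
  {z | ∃ x j, h.SameCycle i j ∧ z = proj h v ((x, half), j)}

/-- The vertical core curve through the square `i`. -/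
def verticalCore (h v : Equiv.Perm (Fin s)) (i : Fin s) : Set (Surface h v) :=
  {z | ∃ y j, v.SameCycle i j ∧ z = proj h v ((half, y), j)}

theorem coe_half : (half : ℝ) = 1 / 2 := rfl

/-- A collapse of the surface to a disc, which sends the open cylinder around the horizontal core
curve through `i` to a punctured disc, and everything else to the origin. -/
theorem exists_collapse (h v : Equiv.Perm (Fin s)) (i : Fin s) :
    ∃ Ψ : Surface h v → ℂ, Continuous Ψ ∧
      (∀ (x y : unitInterval) (k : ℤ), Ψ (proj h v ((x, y), (h ^ k) i)) =
        ((y * (1 - y) : ℝ) : ℂ) * Circle.expPeriod (period h i) (x + k)) ∧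
      ∀ x y j, ¬ h.SameCycle i j → Ψ (proj h v ((x, y), j)) = 0 := by
  classical
  have hn := period_ne_zero h i
  -- The phase at the left side of a square. The exponent chosen does not matter, since two
  -- exponents for the same square differ by a multiple of the period.
  let a : Fin s → ℂ := fun j =>
    if hj : h.SameCycle i j then (Circle.expPeriod (period h i) (hj.choose : ℝ) : ℂ) else 0
  have ha (k : ℤ) : a ((h ^ k) i) = Circle.expPeriod (period h i) (k : ℝ) := by
    have hj : h.SameCycle i ((h ^ k) i) := ⟨k, rfl⟩
    simp only [a, dif_pos hj]
    refine congrArg Subtype.val ((Circle.expPeriod_eq_iff hn).2 ?_)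
    obtain ⟨m, hm⟩ := (zpow_apply_eq_iff h i _ _).1 hj.choose_spec
    refine ⟨m, ?_⟩
    have : ((hj.choose - k : ℤ) : ℝ) = ((period h i * m : ℤ) : ℝ) := congrArg _ hm
    push_cast at this
    linarith
  have ha0 (j) (hj : ¬ h.SameCycle i j) : a j = 0 := dif_neg hj
  have hah (j) : a (h j) = a j * Circle.expPeriod (period h i) 1 := by
    by_cases hj : h.SameCycle i j
    · obtain ⟨k, rfl⟩ := hj
      have h1 : h ((h ^ k) i) = (h ^ (k + 1)) i := by
        rw [add_comm, zpow_add, zpow_one, Equiv.Perm.mul_apply]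
      rw [h1, ha, ha, ← Circle.coe_mul, ← Circle.expPeriod_add]
      push_cast
      rfl
    · rw [ha0 j hj, ha0 _ (by rwa [Equiv.Perm.sameCycle_apply_right]), zero_mul]
  let f : Squares s → ℂ := fun p =>
    ((p.1.2 * (1 - p.1.2) : ℝ) : ℂ) * (a p.2 * Circle.expPeriod (period h i) p.1.1)
  have hf : Continuous f := by
    have h1 : Continuous a := continuous_of_discreteTopology
    have h2 := Circle.continuous_expPeriod (period h i)
    fun_prop
  -- Across a right side the phase advances by one square; on the top and bottom sides the factor `y
  -- * (1 - y)` vanishes.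
  have hglue (p q : Squares s) (hpq : Glue h v p q) : f p = f q := by
    cases hpq with
    | right y j =>
      have : Circle.expPeriod (period h i) 0 = 1 := by simp [Circle.expPeriod]
      simp [f, hah, this]
    | top x j => simp [f]
  refine ⟨Quot.lift f hglue, continuous_quot_lift hglue hf, fun x y k => ?_, fun x y j hj => ?_⟩
  · change f _ = _
    simp only [f, ha]
    rw [← Circle.coe_mul, ← Circle.expPeriod_add, add_comm (k : ℝ)]
  · change f _ = _
    simp [f, ha0 j hj]

theorem mul_one_sub_eq_iff (y : unitInterval) : (y * (1 - y) : ℝ) = 1 / 4 ↔ y = half := by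
  rw [Subtype.ext_iff, coe_half]
  constructor
  · intro hy
    nlinarith [sq_nonneg ((y : ℝ) - 1 / 2)]
  · intro hy
    rw [hy]
    norm_num

/-- Every point of a horizontal line can be written with an abscissa different from `1`. -/
theorem exists_proj_eq_ne_one (h v : Equiv.Perm (Fin s)) (x y : unitInterval) (i : Fin s) (k : ℤ) :
    ∃ (x' : unitInterval) (k' : ℤ), x' ≠ 1 ∧
      proj h v ((x, y), (h ^ k) i) = proj h v ((x', y), (h ^ k') i) := by
  by_cases hx : x = 1
  · refine ⟨0, k + 1, zero_ne_one, ?_⟩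
    rw [hx, proj_one_left, add_comm, zpow_add, zpow_one, Equiv.Perm.mul_apply]
  · exact ⟨x, k, hx, rfl⟩

/-- A real number splits uniquely into an integer and an abscissa in `[0, 1)`; the abscissa `1` is
excluded to have this uniqueness. The exponents then agree modulo the period. -/
theorem proj_eq_of_expPeriod_eq (h v : Equiv.Perm (Fin s)) (i : Fin s) (y : unitInterval)
    {x x' : unitInterval} {k k' : ℤ} (hx : x ≠ 1) (hx' : x' ≠ 1)
    (he : Circle.expPeriod (period h i) (x + k) = Circle.expPeriod (period h i) (x' + k')) :
    proj h v ((x, y), (h ^ k) i) = proj h v ((x', y), (h ^ k') i) := by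
  obtain ⟨m, hm⟩ := (Circle.expPeriod_eq_iff (period_ne_zero h i)).1 he
  have h1 : (x : ℝ) < 1 := lt_of_le_of_ne x.2.2 fun hh => hx (Subtype.ext hh)
  have h1' : (x' : ℝ) < 1 := lt_of_le_of_ne x'.2.2 fun hh => hx' (Subtype.ext hh)
  have h0 := x.2.1
  have h0' := x'.2.1
  have hk : k = k' + m * period h i := by
    have e1 : ((k - (k' + m * period h i) : ℤ) : ℝ) < ((1 : ℤ) : ℝ) := by push_cast; linarith
    have e2 : ((-1 : ℤ) : ℝ) < ((k - (k' + m * period h i) : ℤ) : ℝ) := by push_cast; linarith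
    have e1' := Int.cast_lt.1 e1
    have e2' := Int.cast_lt.1 e2
    linarith
  have hxx : x = x' := by
    rw [hk] at hm
    push_cast at hm
    exact Subtype.ext (by linarith)
  have hj : (h ^ k) i = (h ^ k') i :=
    (zpow_apply_eq_iff h i k k').2 ⟨m, by rw [hk]; ring⟩
  rw [hxx, hj]

/-- The circle coordinate on a horizontal core curve. -/
theorem exists_horizontalCore_homeomorph (h v : Equiv.Perm (Fin s)) (i : Fin s) :
    ∃ e : horizontalCore h v i ≃ₜ Circle, ∀ (x : unitInterval) (k : ℤ),
      (e.symm (Circle.expPeriod (period h i) (x + k)) : Surface h v) =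
        proj h v ((x, half), (h ^ k) i) := by
  obtain ⟨Ψ, hΨ, hΨ1, -⟩ := exists_collapse h v i
  have hval (x : unitInterval) (k : ℤ) : 4 * Ψ (proj h v ((x, half), (h ^ k) i)) =
      Circle.expPeriod (period h i) (x + k) := by
    rw [hΨ1, (mul_one_sub_eq_iff half).2 rfl]
    push_cast
    ring
  have hrep (z : horizontalCore h v i) : ∃ (x : unitInterval) (k : ℤ), x ≠ 1 ∧
      (z : Surface h v) = proj h v ((x, half), (h ^ k) i) := by
    obtain ⟨z, x, j, ⟨k, rfl⟩, rfl⟩ := z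
    exact exists_proj_eq_ne_one h v x half i k
  have hmem (z : horizontalCore h v i) : 4 * Ψ z ∈ Submonoid.unitSphere ℂ := by
    obtain ⟨x, k, -, hz⟩ := hrep z
    rw [hz, hval]
    exact (Circle.expPeriod (period h i) (x + k)).2
  let f : horizontalCore h v i → Circle := fun z => ⟨4 * Ψ z, hmem z⟩
  have hf : Continuous f := Continuous.subtype_mk (by fun_prop) _
  have hfval (x : unitInterval) (k : ℤ) :
      f ⟨proj h v ((x, half), (h ^ k) i), x, _, ⟨k, rfl⟩, rfl⟩ =
        Circle.expPeriod (period h i) (x + k) := Subtype.ext (hval x k)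
  have hinj : Function.Injective f := by
    intro z z' hzz
    obtain ⟨x, k, hx, hz⟩ := hrep z
    obtain ⟨x', k', hx', hz'⟩ := hrep z'
    have he : Circle.expPeriod (period h i) (x + k) = Circle.expPeriod (period h i) (x' + k') := by
      apply Subtype.ext
      rw [← hval, ← hval, ← hz, ← hz']
      exact congrArg Subtype.val hzz
    exact Subtype.ext (hz.trans ((proj_eq_of_expPeriod_eq h v i half hx hx' he).trans hz'.symm))
  have hsurj : Function.Surjective f := by
    intro w
    obtain ⟨t, rfl⟩ := Circle.exists_expPeriod_eq (period_ne_zero h i) w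
    refine ⟨_, (hfval ⟨Int.fract t, Int.fract_nonneg t, (Int.fract_lt_one t).le⟩ ⌊t⌋).trans ?_⟩
    rw [Int.fract_add_floor]
  have hcompact : IsCompact (horizontalCore h v i) := by
    have hK : horizontalCore h v i =
        proj h v '' {p | p.1.2 = half ∧ h.SameCycle i p.2} := by
      ext z
      constructor
      · rintro ⟨x, j, hj, rfl⟩
        exact ⟨((x, half), j), ⟨rfl, hj⟩, rfl⟩
      · rintro ⟨⟨⟨x, y⟩, j⟩, ⟨rfl, hj⟩, rfl⟩
        exact ⟨x, j, hj, rfl⟩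
    rw [hK]
    refine (IsClosed.isCompact ?_).image (continuous_proj h v)
    exact (isClosed_eq (by fun_prop) continuous_const).inter
      ((isClosed_discrete {j | h.SameCycle i j}).preimage continuous_snd)
  have : CompactSpace (horizontalCore h v i) := isCompact_iff_compactSpace.1 hcompact
  -- A continuous bijection from a compact space to the Hausdorff space `Circle` is a homeomorphism,
  -- so no separation property of the surface is needed.
  let e := Continuous.homeoOfEquivCompactToT2 (f := Equiv.ofBijective f ⟨hinj, hsurj⟩) hf
  refine ⟨e, fun x k => ?_⟩
  have : e.symm (Circle.expPeriod (period h i) (x + k)) =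
      ⟨proj h v ((x, half), (h ^ k) i), x, _, ⟨k, rfl⟩, rfl⟩ := by
    rw [Homeomorph.symm_apply_eq]
    exact (hfval x k).symm
  rw [this]

theorem isHorizontalCore_horizontalCore (h v : Equiv.Perm (Fin s)) (i : Fin s) :
    IsHorizontalCore h v (horizontalCore h v i) := by
  obtain ⟨e, -⟩ := exists_horizontalCore_homeomorph h v i
  refine ⟨⟨fun w => e.symm w, by fun_prop, fun w w' hw => e.symm.injective (Subtype.ext hw), ?_⟩,
    ?_⟩
  · rw [← Function.comp_def, Set.range_comp, e.symm.surjective.range_eq, Set.image_univ,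
      Subtype.range_coe]
  · rintro z ⟨x, j, -, rfl⟩
    exact ⟨x, j, rfl⟩

/-- The only horizontal core curves are the obvious ones. -/
theorem IsHorizontalCore.exists_eq {h v : Equiv.Perm (Fin s)} {β : Set (Surface h v)}
    (hβ : IsHorizontalCore h v β) : ∃ i, β = horizontalCore h v i := by
  obtain ⟨⟨γ, hγ, hinj, rfl⟩, hpts⟩ := hβ
  obtain ⟨x₀, i, hi⟩ := hpts (γ 1) (Set.mem_range_self 1)
  obtain ⟨Ψ, hΨ, hΨ1, hΨ0⟩ := exists_collapse h v i
  have hnorm (x : unitInterval) {j : Fin s} (hj : h.SameCycle i j) :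
      ‖Ψ (proj h v ((x, half), j))‖ = 1 / 4 := by
    obtain ⟨k, rfl⟩ := hj
    rw [hΨ1, (mul_one_sub_eq_iff half).2 rfl, norm_mul, Circle.norm_coe]
    norm_num
  have hdich (z : Circle) : ‖Ψ (γ z)‖ = 0 ∨ ‖Ψ (γ z)‖ = 1 / 4 := by
    obtain ⟨x, j, hj⟩ := hpts (γ z) (Set.mem_range_self z)
    by_cases hc : h.SameCycle i j
    · exact Or.inr (hj ▸ hnorm x hc)
    · exact Or.inl (by rw [hj, hΨ0 _ _ _ hc, norm_zero])
  have hsub (z : Circle) : γ z ∈ horizontalCore h v i := by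
    obtain ⟨x, j, hj⟩ := hpts (γ z) (Set.mem_range_self z)
    by_contra hz
    have hc : ¬ h.SameCycle i j := fun hc => hz ⟨x, j, hc, hj⟩
    have hz0 : ‖Ψ (γ z)‖ = 0 := by rw [hj, hΨ0 _ _ _ hc, norm_zero]
    have h1 : ‖Ψ (γ 1)‖ = 1 / 4 := hi ▸ hnorm x₀ (Equiv.Perm.SameCycle.refl h i)
    have hcont : Continuous fun w => ‖Ψ (γ w)‖ := by fun_prop
    -- Along the curve the norm of `Ψ` is `0` or `1/4`; any intermediate value, here `1/8`,
    -- contradicts connectedness of the circle.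
    obtain ⟨w, hw⟩ := mem_range_of_exists_le_of_exists_ge (c := 1 / 8) hcont
      ⟨z, by norm_num [hz0]⟩ ⟨1, by norm_num [h1]⟩
    rcases hdich w with hw' | hw' <;> norm_num [hw'] at hw
  obtain ⟨e, -⟩ := exists_horizontalCore_homeomorph h v i
  -- A simple closed curve inside a circle fills it, so the curve is the whole core and not a part
  -- of it.
  have hs : Function.Surjective fun z => e ⟨γ z, hsub z⟩ := by
    apply Circle.surjective_of_continuous_of_injective
    · fun_prop
    · intro z z' hz
      exact hinj (congrArg Subtype.val (e.injective hz))
  refine ⟨i, Set.Subset.antisymm (Set.range_subset_iff.2 hsub) fun y hy => ?_⟩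
  obtain ⟨z, hz⟩ := hs (e ⟨y, hy⟩)
  exact ⟨z, congrArg Subtype.val (e.injective hz)⟩

/-! ### Transfer from horizontal to vertical curves by symmetry. -/

/-- Exchanging the coordinates exchanges `h` and `v`. -/
def swapFun (h v : Equiv.Perm (Fin s)) : Surface h v → Surface v h :=
  Quot.lift (fun p => proj v h ((p.1.2, p.1.1), p.2)) fun p q hpq => by
    cases hpq with
    | right y j => exact proj_one_right v h y j
    | top x j => exact proj_one_left v h x j

theorem continuous_swapFun (h v : Equiv.Perm (Fin s)) : Continuous (swapFun h v) :=
  continuous_quot_lift _ ((continuous_proj v h).comp (by fun_prop :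
    Continuous fun p : Squares s => (((p.1.2, p.1.1), p.2) : Squares s)))

theorem swapFun_swapFun (h v : Equiv.Perm (Fin s)) (z : Surface h v) :
    swapFun v h (swapFun h v z) = z := by
  induction z using Quot.ind
  rfl

/-- The homeomorphism between `X(h, v)` and `X(v, h)` that exchanges the coordinates. -/
def swap (h v : Equiv.Perm (Fin s)) : Surface h v ≃ₜ Surface v h where
  toFun := swapFun h v
  invFun := swapFun v h
  left_inv := swapFun_swapFun h v
  right_inv := swapFun_swapFun v h
  continuous_toFun := continuous_swapFun h v
  continuous_invFun := continuous_swapFun v h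

theorem swap_proj (h v : Equiv.Perm (Fin s)) (x y : unitInterval) (j : Fin s) :
    swap h v (proj h v ((x, y), j)) = proj v h ((y, x), j) := rfl

theorem swap_preimage_horizontalCore (h v : Equiv.Perm (Fin s)) (i : Fin s) :
    swap h v ⁻¹' horizontalCore v h i = verticalCore h v i := by
  ext z
  refine exists_congr fun y => exists_congr fun j => and_congr_right fun _ => ?_
  rw [← swap_proj h v half y j, (swap h v).injective.eq_iff]

theorem isVerticalCore_iff (h v : Equiv.Perm (Fin s)) (β : Set (Surface h v)) :
    IsVerticalCore h v β ↔ IsHorizontalCore v h ((swap h v).symm ⁻¹' β) := by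
  rw [← Homeomorph.image_eq_preimage_symm]
  refine and_congr ⟨?_, ?_⟩ ?_
  · rintro ⟨γ, hγ, hinj, rfl⟩
    exact ⟨swap h v ∘ γ, (swap h v).continuous.comp hγ, (swap h v).injective.comp hinj,
      Set.range_comp _ _⟩
  · rintro ⟨γ, hγ, hinj, hr⟩
    refine ⟨(swap h v).symm ∘ γ, (swap h v).symm.continuous.comp hγ,
      (swap h v).symm.injective.comp hinj, ?_⟩
    rw [Set.range_comp, hr, ← Set.image_comp]
    simp
  · rw [Set.forall_mem_image]
    refine forall₂_congr fun z _ => exists_congr fun y => exists_congr fun j => ?_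
    rw [← swap_proj h v half y j, (swap h v).injective.eq_iff]

theorem isVerticalCore_verticalCore (h v : Equiv.Perm (Fin s)) (i : Fin s) :
    IsVerticalCore h v (verticalCore h v i) := by
  rw [isVerticalCore_iff, ← swap_preimage_horizontalCore, ← Set.preimage_comp]
  simpa using isHorizontalCore_horizontalCore v h i

theorem IsVerticalCore.exists_eq {h v : Equiv.Perm (Fin s)} {β : Set (Surface h v)}
    (hβ : IsVerticalCore h v β) : ∃ i, β = verticalCore h v i := by
  obtain ⟨i, hi⟩ := ((isVerticalCore_iff h v β).1 hβ).exists_eq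
  refine ⟨i, ?_⟩
  rw [← swap_preimage_horizontalCore, ← hi, ← Set.preimage_comp]
  simp

end Origami

namespace Origami

variable {s : ℕ}

/-! ### The intersection number of a horizontal and a vertical core curve -/

open Classical in
/-- The indicator function of the cycle of `σ` through `i`. -/
noncomputable def cycleIndicator (σ : Equiv.Perm (Fin s)) (i j : Fin s) : ℝ :=
  if σ.SameCycle i j then 1 else 0

theorem cycleIndicator_of_sameCycle {σ : Equiv.Perm (Fin s)} {i j : Fin s}
    (hj : σ.SameCycle i j) : cycleIndicator σ i j = 1 := if_pos hj

theorem cycleIndicator_of_not_sameCycle {σ : Equiv.Perm (Fin s)} {i j : Fin s}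
    (hj : ¬ σ.SameCycle i j) : cycleIndicator σ i j = 0 := if_neg hj

theorem cycleIndicator_nonneg (σ : Equiv.Perm (Fin s)) (i j : Fin s) :
    0 ≤ cycleIndicator σ i j := by
  unfold cycleIndicator
  split_ifs <;> norm_num

theorem cycleIndicator_apply (σ : Equiv.Perm (Fin s)) (i j : Fin s) :
    cycleIndicator σ i (σ j) = cycleIndicator σ i j := by
  simp only [cycleIndicator, Equiv.Perm.sameCycle_apply_right]

/-- Makes the product of the indicator and the abscissa, read modulo `1`, agree on the two sides of
a right gluing. -/
theorem coe_cycleIndicator (σ : Equiv.Perm (Fin s)) (i j : Fin s) :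
    (cycleIndicator σ i j : UnitAddCircle) = 0 := by
  unfold cycleIndicator
  split_ifs
  · exact AddCircle.coe_period 1
  · rfl

/-- The collapse of the surface to a circle whose fibre over `1/2` is the vertical core curve
through `i`. -/
theorem exists_circle_collapse (h v : Equiv.Perm (Fin s)) (i : Fin s) :
    ∃ p : Surface h v → UnitAddCircle, Continuous p ∧
      (∀ x y j, p (proj h v ((x, y), j)) = ((cycleIndicator v i j * x : ℝ) : UnitAddCircle)) ∧
      p ⁻¹' {((1 / 2 : ℝ) : UnitAddCircle)} = verticalCore h v i := by
  let f : Squares s → UnitAddCircle := fun p =>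
    ((cycleIndicator v i p.2 * (p.1.1 : ℝ) : ℝ) : UnitAddCircle)
  have hf : Continuous f := by
    have h1 : Continuous (cycleIndicator v i) := continuous_of_discreteTopology
    have h2 : Continuous ((↑) : ℝ → UnitAddCircle) := (AddCircle.isCoveringMap_coe 1).continuous
    exact h2.comp (by fun_prop)
  have hglue (p q : Squares s) (hpq : Glue h v p q) : f p = f q := by
    cases hpq with
    | right y j => simp [f, coe_cycleIndicator]
    | top x j => simp [f, cycleIndicator_apply]
  refine ⟨Quot.lift f hglue, continuous_quot_lift hglue hf, fun x y j => rfl, ?_⟩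
  ext z
  obtain ⟨⟨⟨x, y⟩, j⟩, rfl⟩ := Quot.exists_rep z
  constructor
  · intro hz
    change ((cycleIndicator v i j * (x : ℝ) : ℝ) : UnitAddCircle) = _ at hz
    obtain ⟨m, hm⟩ := UnitAddCircle.coe_eq_coe_iff.1 hz
    by_cases hj : v.SameCycle i j
    · refine ⟨y, j, hj, ?_⟩
      rw [cycleIndicator_of_sameCycle hj, one_mul] at hm
      have h0 := x.2.1
      have h1 := x.2.2
      have e1 : (m : ℝ) < ((1 : ℤ) : ℝ) := by push_cast; linarith
      have e2 : ((-1 : ℤ) : ℝ) < m := by push_cast; linarith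
      have hm0 : m = 0 := by
        have := Int.cast_lt.1 e1
        have := Int.cast_lt.1 e2
        lia
      have hx : x = half := by
        rw [hm0] at hm
        exact Subtype.ext (by rw [coe_half]; push_cast at hm; linarith)
      rw [hx]
      rfl
    · exfalso
      rw [cycleIndicator_of_not_sameCycle hj, zero_mul, zero_add] at hm
      have hm2 : ((1 : ℤ) : ℝ) = ((2 * m : ℤ) : ℝ) := by push_cast; linarith
      have := Int.cast_injective hm2
      lia
  · rintro ⟨y', j', hj, hz⟩
    rw [hz]
    change ((cycleIndicator v i j' * (half : ℝ) : ℝ) : UnitAddCircle) = _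
    rw [cycleIndicator_of_sameCycle hj, one_mul, coe_half]

/-- The clamp of a real number to the unit interval. -/
noncomputable def clamp (t : ℝ) : ℝ := max 0 (min 1 t)

theorem continuous_clamp : Continuous clamp := by
  unfold clamp
  fun_prop

theorem clamp_of_nonpos {t : ℝ} (ht : t ≤ 0) : clamp t = 0 := by
  rw [clamp, min_eq_right (by linarith), max_eq_left ht]

theorem clamp_of_one_le {t : ℝ} (ht : 1 ≤ t) : clamp t = 1 := by
  rw [clamp, min_eq_left ht, max_eq_right zero_le_one]

theorem clamp_of_mem {t : ℝ} (h0 : 0 ≤ t) (h1 : t ≤ 1) : clamp t = t := by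
  rw [clamp, min_eq_right h1, max_eq_right h0]

/-- In a geometrically simple origami, a cycle of `h` and a cycle of `v` have at most one square
in common. -/
theorem IsGeometricallySimple.eq_of_sameCycle {h v : Equiv.Perm (Fin s)}
    (hs : IsGeometricallySimple h v) {i j : Fin s} (hh : h.SameCycle i j)
    (hv : v.SameCycle i j) : i = j := by
  by_contra hne
  obtain ⟨p, hp, hpval, hfib⟩ := exists_circle_collapse h v i
  obtain ⟨e, he⟩ := exists_horizontalCore_homeomorph h v i
  set n := period h i with hn_def
  have hn : n ≠ 0 := period_ne_zero h i
  have hn0 : (0 : ℝ) < n := by exact_mod_cast Nat.pos_of_ne_zero hn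
  let γ : unitInterval → Surface h v := fun θ => e.symm (Circle.expPeriod n (n * θ))
  have hγ : Continuous γ := by
    have := Circle.continuous_expPeriod n
    fun_prop
  have hγ0 : γ 0 = proj h v ((0, half), i) := by
    have := he 0 0
    simpa [γ] using this
  have hloop : γ 0 = γ 1 := by
    have : Circle.expPeriod n (n * ((0 : unitInterval) : ℝ)) =
        Circle.expPeriod n (n * ((1 : unitInterval) : ℝ)) :=
      (Circle.expPeriod_eq_iff hn).2 ⟨-1, by simp⟩
    simp only [γ, this]
  have hinj : Set.InjOn γ {1}ᶜ := by
    intro θ hθ θ' hθ' heq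
    have h1 := e.symm.injective (Subtype.ext heq)
    obtain ⟨m, hm⟩ := (Circle.expPeriod_eq_iff hn).1 h1
    have hm' : (θ : ℝ) = θ' + m := by
      have : (n : ℝ) * θ = n * (θ' + m) := by rw [hm]; ring
      exact mul_left_cancel₀ hn0.ne' this
    have b1 : (θ : ℝ) < 1 := lt_of_le_of_ne θ.2.2 fun hh => hθ (Subtype.ext hh)
    have b1' : (θ' : ℝ) < 1 := lt_of_le_of_ne θ'.2.2 fun hh => hθ' (Subtype.ext hh)
    have b0 := θ.2.1
    have b0' := θ'.2.1
    have e1 : (m : ℝ) < ((1 : ℤ) : ℝ) := by push_cast; linarith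
    have e2 : ((-1 : ℤ) : ℝ) < m := by push_cast; linarith
    have hm0 : m = 0 := by
      have := Int.cast_lt.1 e1
      have := Int.cast_lt.1 e2
      lia
    rw [hm0] at hm'
    exact Subtype.ext (by simpa using hm')
  have hrange : Set.range γ = horizontalCore h v i := by
    refine Set.Subset.antisymm (Set.range_subset_iff.2 fun θ => (e.symm _).2) fun z hz => ?_
    obtain ⟨t, ht⟩ := Circle.exists_expPeriod_eq hn (e ⟨z, hz⟩)
    refine ⟨⟨Int.fract (t / n), Int.fract_nonneg _, (Int.fract_lt_one _).le⟩, ?_⟩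
    have h2 : Circle.expPeriod n (n * Int.fract (t / n)) = e ⟨z, hz⟩ := by
      rw [← ht, Circle.expPeriod_eq_iff hn]
      refine ⟨-⌊t / n⌋, ?_⟩
      rw [← Int.self_sub_floor]
      push_cast
      field_simp
      ring
    simp only [γ, h2, Homeomorph.symm_apply_apply]
  -- The lift of `p ∘ γ`: it grows by `1` while the curve crosses a square of the vertical cylinder
  -- and is constant while it crosses any other square.
  let L : unitInterval → ℝ := fun θ =>
    ∑ k ∈ Finset.range n, cycleIndicator v i ((h ^ k) i) * clamp (n * θ - k)
  have hL : Continuous L := by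
    have := continuous_clamp
    fun_prop
  have hL0 : L 0 = 0 := by
    refine Finset.sum_eq_zero fun k _ => ?_
    rw [clamp_of_nonpos (by simp), mul_zero]
  have hL1 : L 1 = ∑ k ∈ Finset.range n, cycleIndicator v i ((h ^ k) i) := by
    refine Finset.sum_congr rfl fun k hk => ?_
    have hk' : ((k + 1 : ℕ) : ℝ) ≤ n := by exact_mod_cast Finset.mem_range.1 hk
    push_cast at hk'
    rw [clamp_of_one_le (by simp; linarith), mul_one]
  have hcoe (S : Finset ℕ) (g : ℕ → ℝ) :
      ((∑ k ∈ S, g k : ℝ) : UnitAddCircle) = ∑ k ∈ S, (g k : UnitAddCircle) :=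
    map_sum (QuotientAddGroup.mk' (AddSubgroup.zmultiples (1 : ℝ))) g S
  have hpL (θ : unitInterval) : p (γ θ) = L θ := by
    by_cases hθ : θ = 1
    -- The end point is separate because `⌊n⌋₊ = n` lies outside the range of summation; both sides
    -- are `0` in `ℝ/ℤ`.
    · rw [hθ, ← hloop, hγ0, hpval, hL1, hcoe, Finset.sum_eq_zero fun k _ => coe_cycleIndicator v i _]
      simp
    · have hθ1 : (θ : ℝ) < 1 := lt_of_le_of_ne θ.2.2 fun hh => hθ (Subtype.ext hh)
      have ht0 : 0 ≤ (n : ℝ) * θ := mul_nonneg hn0.le θ.2.1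
      have htn : (n : ℝ) * θ < n := by nlinarith
      set t := (n : ℝ) * θ with ht
      have hk0 := Nat.floor_le ht0
      have hk1 := Nat.lt_floor_add_one t
      have hkn : ⌊t⌋₊ < n := (Nat.floor_lt ht0).2 htn
      have hγθ : γ θ = proj h v ((⟨t - ⌊t⌋₊, by linarith, by linarith⟩, half), (h ^ ⌊t⌋₊) i) := by
        have := he ⟨t - ⌊t⌋₊, by linarith, by linarith⟩ ⌊t⌋₊
        simp only [Int.cast_natCast, sub_add_cancel, zpow_natCast] at this
        exact this
      -- Modulo `1` only the square being crossed counts: the terms of earlier squares are integers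
      -- and those of later squares vanish.
      rw [hγθ, hpval, hcoe, Finset.sum_eq_single ⌊t⌋₊]
      · rw [clamp_of_mem (by linarith) (by linarith)]
      · intro k _ hk
        rcases lt_or_gt_of_ne hk with hlt | hlt
        · have : ((k + 1 : ℕ) : ℝ) ≤ ⌊t⌋₊ := by exact_mod_cast hlt
          push_cast at this
          rw [clamp_of_one_le (by linarith), mul_one, coe_cycleIndicator]
        · have : ((⌊t⌋₊ + 1 : ℕ) : ℝ) ≤ k := by exact_mod_cast hlt
          push_cast at this
          rw [clamp_of_nonpos (by linarith), mul_zero]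
          rfl
      · intro hk
        exact absurd (Finset.mem_range.2 hkn) hk
  -- The squares `i` and `j`, met at the distinct indices `0` and `r`, contribute `1` each. Here `r`
  -- is the exponent taking `i` to `j`, reduced modulo the period.
  have h2 : 2 ≤ L 1 - L 0 := by
    obtain ⟨m, hm⟩ := hh
    have hn1 : (0 : ℤ) < n := by exact_mod_cast Nat.pos_of_ne_zero hn
    obtain ⟨r, hr⟩ := Int.eq_ofNat_of_zero_le (Int.emod_nonneg m hn1.ne')
    have hrj : (h ^ r) i = j := by
      rw [← hm, ← zpow_natCast, zpow_apply_eq_iff, ← hn_def, ← hr]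
      exact ⟨-(m / n), by rw [Int.emod_def]; ring⟩
    have hrn : r < n := by
      have := Int.emod_lt_of_pos m hn1
      lia
    have hr0 : 0 ≠ r := by
      rintro rfl
      exact hne (by simpa using hrj)
    rw [hL0, sub_zero, hL1]
    calc (2 : ℝ) = ∑ k ∈ ({0, r} : Finset ℕ), cycleIndicator v i ((h ^ k) i) := by
          rw [Finset.sum_pair hr0, hrj, cycleIndicator_of_sameCycle hv, pow_zero,
            Equiv.Perm.one_apply, cycleIndicator_of_sameCycle (Equiv.Perm.SameCycle.refl v i)]
          norm_num
      _ ≤ _ := Finset.sum_le_sum_of_subset_of_nonneg (by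
            intro k hk
            rw [Finset.mem_insert, Finset.mem_singleton] at hk
            rw [Finset.mem_range]
            rcases hk with rfl | rfl <;> lia) fun k _ _ => cycleIndicator_nonneg v i _
  have hge := two_le_geometricIntersection hp hγ hloop hinj hL hpL h2
  rw [hrange, hfib] at hge
  have hle := hs _ (Or.inl (isHorizontalCore_horizontalCore h v i)) _
    (Or.inr (isVerticalCore_verticalCore h v i))
  exact absurd (hge.trans hle) (by norm_num)

end Origami

namespace Origami

variable {s : ℕ}

/-! ### The intersection graph of the core curves -/

theorem horizontalCore_eq_of_sameCycle {h v : Equiv.Perm (Fin s)} {i j : Fin s}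
    (hij : h.SameCycle i j) : horizontalCore h v i = horizontalCore h v j := by
  ext z
  exact exists_congr fun x => exists_congr fun k => and_congr_left fun _ =>
    ⟨fun hk => hij.symm.trans hk, fun hk => hij.trans hk⟩

theorem verticalCore_eq_of_sameCycle {h v : Equiv.Perm (Fin s)} {i j : Fin s}
    (hij : v.SameCycle i j) : verticalCore h v i = verticalCore h v j := by
  rw [← swap_preimage_horizontalCore, horizontalCore_eq_of_sameCycle hij,
    swap_preimage_horizontalCore]

/-- A point of a horizontal core curve that is written in coordinates of the square `j` shows that
`j` belongs to the corresponding cycle. -/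
theorem sameCycle_of_proj_mem_horizontalCore {h v : Equiv.Perm (Fin s)} {i j : Fin s}
    {x y : unitInterval} (hz : proj h v ((x, y), j) ∈ horizontalCore h v i) : h.SameCycle i j := by
  obtain ⟨Ψ, -, hΨ1, hΨ0⟩ := exists_collapse h v i
  obtain ⟨x', _, ⟨k, rfl⟩, hz⟩ := hz
  by_contra hj
  have h1 := congrArg (fun z => ‖Ψ z‖) hz
  simp only [hΨ0 _ _ _ hj, hΨ1, (mul_one_sub_eq_iff half).2 rfl, norm_mul, Circle.norm_coe] at h1
  norm_num at h1

theorem sameCycle_of_horizontalCore_inter {h v : Equiv.Perm (Fin s)} {i j : Fin s}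
    (hz : (horizontalCore h v i ∩ horizontalCore h v j).Nonempty) : h.SameCycle i j := by
  obtain ⟨_, h1, x, k, hk, rfl⟩ := hz
  exact (sameCycle_of_proj_mem_horizontalCore h1).trans hk.symm

theorem sameCycle_of_verticalCore_inter {h v : Equiv.Perm (Fin s)} {i j : Fin s}
    (hz : (verticalCore h v i ∩ verticalCore h v j).Nonempty) : v.SameCycle i j := by
  rw [← swap_preimage_horizontalCore, ← swap_preimage_horizontalCore, ← Set.preimage_inter] at hz
  obtain ⟨z, hz⟩ := hz
  exact sameCycle_of_horizontalCore_inter ⟨_, hz⟩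

theorem horizontalCore_inter_verticalCore {h v : Equiv.Perm (Fin s)} {i j : Fin s}
    (hz : (horizontalCore h v i ∩ verticalCore h v j).Nonempty) :
    ∃ k, h.SameCycle i k ∧ v.SameCycle j k := by
  obtain ⟨_, h1, x, k, hk, rfl⟩ := hz
  exact ⟨k, sameCycle_of_proj_mem_horizontalCore h1, hk⟩

theorem proj_half_mem_horizontalCore (h v : Equiv.Perm (Fin s)) (x : unitInterval) (i : Fin s) :
    proj h v ((x, half), i) ∈ horizontalCore h v i :=
  ⟨x, i, Equiv.Perm.SameCycle.refl h i, rfl⟩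

theorem proj_half_mem_verticalCore (h v : Equiv.Perm (Fin s)) (y : unitInterval) (i : Fin s) :
    proj h v ((half, y), i) ∈ verticalCore h v i :=
  ⟨y, i, Equiv.Perm.SameCycle.refl v i, rfl⟩

/-- The horizontal core contains a point of abscissa `0`, which the circle collapse sends to `0` and
not to `1/2`. -/
theorem horizontalCore_ne_verticalCore (h v : Equiv.Perm (Fin s)) (i j : Fin s) :
    horizontalCore h v i ≠ verticalCore h v j := by
  intro heq
  obtain ⟨p, -, hp, hfib⟩ := exists_circle_collapse h v j
  have hz := proj_half_mem_horizontalCore h v 0 i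
  rw [heq, ← hfib, Set.mem_preimage, hp, Set.mem_singleton_iff] at hz
  obtain ⟨m, hm⟩ := UnitAddCircle.coe_eq_coe_iff.1 hz
  have hm2 : ((1 : ℤ) : ℝ) = ((2 * m : ℤ) : ℝ) := by
    simp only [Set.Icc.coe_zero, mul_zero, zero_add] at hm
    push_cast
    linarith
  have := Int.cast_injective hm2
  lia

theorem horizontalCore_eq_iff {h v : Equiv.Perm (Fin s)} {i j : Fin s} :
    horizontalCore h v i = horizontalCore h v j ↔ h.SameCycle i j := by
  refine ⟨fun heq => sameCycle_of_horizontalCore_inter (v := v) ?_, horizontalCore_eq_of_sameCycle⟩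
  rw [← heq, Set.inter_self]
  exact ⟨_, proj_half_mem_horizontalCore h v 0 i⟩

theorem verticalCore_eq_iff {h v : Equiv.Perm (Fin s)} {i j : Fin s} :
    verticalCore h v i = verticalCore h v j ↔ v.SameCycle i j := by
  refine ⟨fun heq => sameCycle_of_verticalCore_inter (h := h) ?_, verticalCore_eq_of_sameCycle⟩
  rw [← heq, Set.inter_self]
  exact ⟨_, proj_half_mem_verticalCore h v 0 i⟩

/-- The vertex of the intersection graph given by the horizontal core curve through `i`. -/
def horizontalVertex (h v : Equiv.Perm (Fin s)) (i : Fin s) : network h v :=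
  ⟨horizontalCore h v i, Or.inl (isHorizontalCore_horizontalCore h v i)⟩

/-- The vertex of the intersection graph given by the vertical core curve through `i`. -/
def verticalVertex (h v : Equiv.Perm (Fin s)) (i : Fin s) : network h v :=
  ⟨verticalCore h v i, Or.inr (isVerticalCore_verticalCore h v i)⟩

theorem horizontalVertex_eq_iff {h v : Equiv.Perm (Fin s)} {i j : Fin s} :
    horizontalVertex h v i = horizontalVertex h v j ↔ h.SameCycle i j :=
  Subtype.ext_iff.trans horizontalCore_eq_iff

theorem verticalVertex_eq_iff {h v : Equiv.Perm (Fin s)} {i j : Fin s} :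
    verticalVertex h v i = verticalVertex h v j ↔ v.SameCycle i j :=
  Subtype.ext_iff.trans verticalCore_eq_iff

theorem horizontalVertex_ne_verticalVertex (h v : Equiv.Perm (Fin s)) (i j : Fin s) :
    horizontalVertex h v i ≠ verticalVertex h v j := fun heq =>
  horizontalCore_ne_verticalCore h v i j (congrArg Subtype.val heq)

theorem network_cases {h v : Equiv.Perm (Fin s)} (η : network h v) :
    (∃ i, η = horizontalVertex h v i) ∨ ∃ i, η = verticalVertex h v i := by
  obtain ⟨β, hβ | hβ⟩ := η
  · obtain ⟨i, rfl⟩ := hβ.exists_eq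
    exact Or.inl ⟨i, rfl⟩
  · obtain ⟨i, rfl⟩ := hβ.exists_eq
    exact Or.inr ⟨i, rfl⟩

/-- The core curves correspond to the cycles of `h` and of `v`. -/
theorem exists_network_equiv (h v : Equiv.Perm (Fin s)) :
    Nonempty (Quotient (Equiv.Perm.SameCycle.setoid h) ⊕
      Quotient (Equiv.Perm.SameCycle.setoid v) ≃ network h v) := by
  let f : Quotient (Equiv.Perm.SameCycle.setoid h) → network h v :=
    Quotient.lift (horizontalVertex h v) fun _ _ hij => horizontalVertex_eq_iff.2 hij
  let g : Quotient (Equiv.Perm.SameCycle.setoid v) → network h v :=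
    Quotient.lift (verticalVertex h v) fun _ _ hij => verticalVertex_eq_iff.2 hij
  refine ⟨Equiv.ofBijective (Sum.elim f g) ⟨Function.Injective.sumElim ?_ ?_ ?_, ?_⟩⟩
  · intro c c'
    induction c using Quotient.inductionOn
    induction c' using Quotient.inductionOn
    exact fun heq => Quotient.sound (horizontalVertex_eq_iff.1 heq)
  · intro c c'
    induction c using Quotient.inductionOn
    induction c' using Quotient.inductionOn
    exact fun heq => Quotient.sound (verticalVertex_eq_iff.1 heq)
  · intro c c'
    induction c using Quotient.inductionOn
    induction c' using Quotient.inductionOn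
    exact horizontalVertex_ne_verticalVertex h v _ _
  · intro η
    rcases network_cases η with ⟨i, rfl⟩ | ⟨i, rfl⟩
    · exact ⟨Sum.inl ⟦i⟧, rfl⟩
    · exact ⟨Sum.inr ⟦i⟧, rfl⟩

theorem finite_network (h v : Equiv.Perm (Fin s)) : Finite (network h v) :=
  (exists_network_equiv h v).elim fun e => Finite.of_equiv _ e

theorem card_network (h v : Equiv.Perm (Fin s)) :
    Nat.card (network h v) = numCycles h + numCycles v := by
  obtain ⟨e⟩ := exists_network_equiv h v
  rw [← Nat.card_congr e, Nat.card_sum]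
  rfl

theorem adj_horizontalVertex_verticalVertex (h v : Equiv.Perm (Fin s)) (i : Fin s) :
    (intersectionGraph h v).Adj (horizontalVertex h v i) (verticalVertex h v i) :=
  ⟨horizontalVertex_ne_verticalVertex h v i i, _, proj_half_mem_horizontalCore h v half i,
    proj_half_mem_verticalCore h v half i⟩

/-- An equivalence relation on the squares that is compatible with `h` and `v` is trivial. -/
theorem IsOrigami.setoid_eq_top {h v : Equiv.Perm (Fin s)} (hX : IsOrigami h v)
    (r : Setoid (Fin s)) (hh : ∀ j, r j (h j)) (hv : ∀ j, r j (v j)) (i j : Fin s) : r i j := by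
  obtain ⟨⟨g, hg⟩, hgij⟩ := hX.2.exists_smul_eq i j
  change g i = j at hgij
  rw [← hgij]
  clear hgij
  induction hg using Subgroup.closure_induction generalizing i with
  | mem g hg =>
    rcases hg with rfl | rfl
    · exact hh i
    · exact hv i
  | one => exact r.refl i
  | mul a b _ _ iha ihb => exact r.trans (ihb i) (iha (b i))
  | inv a _ iha =>
    have := iha (a⁻¹ i)
    rw [← Equiv.Perm.mul_apply, mul_inv_cancel, Equiv.Perm.one_apply] at this
    exact r.symm this

/-- Passing from `j` to `h j` stays on one horizontal core, and the horizontal cores through `j` and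
`v j` both meet the vertical core through `j`. Transitivity links all squares by such moves. -/
theorem IsOrigami.connected {h v : Equiv.Perm (Fin s)} (hX : IsOrigami h v) :
    (intersectionGraph h v).Connected := by
  have hadj (i) := (adj_horizontalVertex_verticalVertex h v i).reachable
  have hreach (i j : Fin s) :
      (intersectionGraph h v).Reachable (horizontalVertex h v i) (horizontalVertex h v j) := by
    refine hX.setoid_eq_top
      ((intersectionGraph h v).reachableSetoid.comap (horizontalVertex h v)) (fun j => ?_)
      (fun j => ?_) i j
    · change (intersectionGraph h v).Reachable _ _
      rw [horizontalVertex_eq_iff.2 (Equiv.Perm.sameCycle_apply_right.2 (.refl h j))]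
    · have := hadj (v j)
      rw [← verticalVertex_eq_iff.2 (Equiv.Perm.sameCycle_apply_right.2 (.refl v j))] at this
      exact (hadj j).trans this.symm
  have hall (η : network h v) : ∃ i, (intersectionGraph h v).Reachable η
      (horizontalVertex h v i) := by
    rcases network_cases η with ⟨i, rfl⟩ | ⟨i, rfl⟩
    · exact ⟨i, .rfl⟩
    · exact ⟨i, (hadj i).symm⟩
  have : Nonempty (network h v) := ⟨horizontalVertex h v ⟨0, hX.1⟩⟩
  refine ⟨fun η η' => ?_⟩
  obtain ⟨i, hi⟩ := hall η
  obtain ⟨j, hj⟩ := hall η'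
  exact hi.trans ((hreach i j).trans hj.symm)

/-- If a cycle of `h` and a cycle of `v` have at most one square in common, then the edges of the
intersection graph correspond to the squares. -/
theorem card_edgeSet {h v : Equiv.Perm (Fin s)}
    (hs : ∀ i j, h.SameCycle i j → v.SameCycle i j → i = j) :
    Nat.card (intersectionGraph h v).edgeSet = s := by
  let f : Fin s → (intersectionGraph h v).edgeSet := fun i =>
    ⟨s(horizontalVertex h v i, verticalVertex h v i), adj_horizontalVertex_verticalVertex h v i⟩
  have hf : Function.Bijective f := by
    constructor
    · intro i j hij
      rcases Sym2.eq_iff.1 (congrArg Subtype.val hij) with ⟨h1, h2⟩ | ⟨h1, -⟩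
      · exact hs i j (horizontalVertex_eq_iff.1 h1) (verticalVertex_eq_iff.1 h2)
      · exact absurd h1 (horizontalVertex_ne_verticalVertex h v i j)
    · have key (i j : Fin s) (hz : (horizontalCore h v i ∩ verticalCore h v j).Nonempty) :
          ∃ k, (f k : Sym2 (network h v)) = s(horizontalVertex h v i, verticalVertex h v j) := by
        obtain ⟨k, hk, hk'⟩ := horizontalCore_inter_verticalCore hz
        exact ⟨k, by rw [horizontalVertex_eq_iff.2 hk, verticalVertex_eq_iff.2 hk']⟩
      rintro ⟨e, he⟩
      induction e with
      | _ η η' =>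
        obtain ⟨hne, hz⟩ := he
        rcases network_cases η with ⟨i, rfl⟩ | ⟨i, rfl⟩ <;>
          rcases network_cases η' with ⟨j, rfl⟩ | ⟨j, rfl⟩
        · exact absurd (horizontalVertex_eq_iff.2 (sameCycle_of_horizontalCore_inter hz)) hne
        · obtain ⟨k, hk⟩ := key i j hz
          exact ⟨k, Subtype.ext hk⟩
        · rw [Set.inter_comm] at hz
          obtain ⟨k, hk⟩ := key j i hz
          exact ⟨k, Subtype.ext (hk.trans Sym2.eq_swap)⟩
        · exact absurd (verticalVertex_eq_iff.2 (sameCycle_of_verticalCore_inter hz)) hne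
  rw [← Nat.card_congr (Equiv.ofBijective f hf), Nat.card_fin]

theorem isArboreal_iff {h v : Equiv.Perm (Fin s)} (hX : IsOrigami h v)
    (hs : ∀ i j, h.SameCycle i j → v.SameCycle i j → i = j) :
    IsArboreal h v ↔ numCycles h + numCycles v = s + 1 := by
  have := finite_network h v
  rw [IsArboreal, SimpleGraph.isTree_iff_connected_and_card, card_edgeSet hs, card_network,
    and_iff_right hX.connected, eq_comm]

end Origami

namespace Origami

variable {s : ℕ}

/-! ### Counting cycles by linear algebra -/

/-- The functions on the squares that are invariant under `σ`. -/
def invariants (σ : Equiv.Perm (Fin s)) : Submodule ℚ (Fin s → ℚ) :=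
  LinearMap.ker (LinearMap.funLeft ℚ ℚ σ - LinearMap.id)

theorem mem_invariants {σ : Equiv.Perm (Fin s)} {f : Fin s → ℚ} :
    f ∈ invariants σ ↔ ∀ j, f (σ j) = f j := by
  simp [invariants, funext_iff, LinearMap.funLeft_apply, sub_eq_zero]

/-- An invariant function is the same as a function on the set of cycles. -/
theorem finrank_invariants (σ : Equiv.Perm (Fin s)) :
    Module.finrank ℚ (invariants σ) = numCycles σ := by
  let q : Fin s → Quotient (Equiv.Perm.SameCycle.setoid σ) := Quotient.mk _
  have hq : Function.Surjective q := Quotient.mk_surjective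
  have hrange : LinearMap.range (LinearMap.funLeft ℚ ℚ q) = invariants σ := by
    ext f
    rw [mem_invariants]
    constructor
    · rintro ⟨g, rfl⟩ j
      refine congrArg g (Quotient.sound ?_)
      exact Equiv.Perm.sameCycle_apply_left.2 (.refl σ j)
    · intro hf
      have hpow (k : ℕ) (j : Fin s) : f ((σ ^ k) j) = f j := by
        induction k with
        | zero => rfl
        | succ k ih => rw [pow_succ', Equiv.Perm.mul_apply, hf, ih]
      refine ⟨Quotient.lift f fun i j hij => ?_, rfl⟩
      obtain ⟨k, -, hk⟩ := Equiv.Perm.SameCycle.exists_pow_eq' hij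
      rw [← hk, hpow]
  have := Fintype.ofFinite (Quotient (Equiv.Perm.SameCycle.setoid σ))
  rw [← hrange, LinearMap.finrank_range_of_inj (LinearMap.funLeft_injective_of_surjective ℚ ℚ q hq),
    Module.finrank_fintype_fun_eq_card, numCycles, Nat.card_eq_fintype_card]

/-! ### Rank of the divergence and cylinder classes. -/

/-- The map whose kernel is the rational homology of the dual graph. -/
def divergence (h v : Equiv.Perm (Fin s)) : (Fin s → ℚ) × (Fin s → ℚ) →ₗ[ℚ] Fin s → ℚ :=
  (LinearMap.funLeft ℚ ℚ h - LinearMap.id).coprod (LinearMap.funLeft ℚ ℚ v - LinearMap.id)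

theorem divergence_apply (h v : Equiv.Perm (Fin s)) (l b : Fin s → ℚ) (j : Fin s) :
    divergence h v (l, b) j = l (h j) - l j + (b (v j) - b j) := rfl

/-- The images of unit vectors are the differences of the unit vectors at `j` and `h j`, or at `j`
and `v j`. By transitivity these generate the differences for all pairs of squares, which span the
functions of sum zero. -/
theorem range_divergence {h v : Equiv.Perm (Fin s)} (hX : IsOrigami h v) :
    LinearMap.range (divergence h v) = LinearMap.ker (∑ j, LinearMap.proj j : (Fin s → ℚ) →ₗ[ℚ] ℚ) := by
  apply le_antisymm
  · rintro _ ⟨⟨l, b⟩, rfl⟩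
    simp [LinearMap.sum_apply, divergence_apply, Finset.sum_add_distrib, Equiv.sum_comp]
  · intro f hf
    let r : Setoid (Fin s) :=
      { r := fun i j => (Pi.single i 1 - Pi.single j 1 : Fin s → ℚ) ∈ LinearMap.range (divergence h v)
        iseqv :=
          { refl := fun i => by simp
            symm := fun {i j} hij => by simpa using neg_mem hij
            trans := fun {i j k} hij hjk => by simpa using add_mem hij hjk } }
    have hr : ∀ i j, r i j := by
      refine hX.setoid_eq_top r (fun j => ⟨(Pi.single (h j) 1, 0), ?_⟩)
        (fun j => ⟨(0, Pi.single (v j) 1), ?_⟩)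
      · ext k
        simp [divergence_apply, Pi.single_apply]
      · ext k
        simp [divergence_apply, Pi.single_apply]
    have hsum : ∑ j, f j = 0 := by simpa [LinearMap.sum_apply] using hf
    have hf' : f = ∑ j, f j • (Pi.single j 1 - Pi.single ⟨0, hX.1⟩ 1 : Fin s → ℚ) := by
      simp only [smul_sub, Finset.sum_sub_distrib, ← Finset.sum_smul, hsum, zero_smul, sub_zero]
      exact pi_eq_sum_univ' f
    rw [hf']
    exact Submodule.sum_mem _ fun j _ => Submodule.smul_mem _ _ (hr j _)

/-- Rank-nullity: the range has dimension `s - 1` in a target of a map from dimension `2 * s`. -/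
theorem finrank_ker_divergence {h v : Equiv.Perm (Fin s)} (hX : IsOrigami h v) :
    Module.finrank ℚ (LinearMap.ker (divergence h v)) = s + 1 := by
  have hs := hX.1
  have h1 := LinearMap.finrank_range_add_finrank_ker (divergence h v)
  have h2 := LinearMap.finrank_range_add_finrank_ker
    (∑ j, LinearMap.proj j : (Fin s → ℚ) →ₗ[ℚ] ℚ)
  have hsurj : Function.Surjective (∑ j, LinearMap.proj j : (Fin s → ℚ) →ₗ[ℚ] ℚ) := fun c =>
    ⟨Pi.single ⟨0, hs⟩ c, by simp [LinearMap.sum_apply]⟩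
  rw [range_divergence hX] at h1
  rw [LinearMap.range_eq_top.2 hsurj, finrank_top] at h2
  simp only [Module.finrank_prod, Module.finrank_fintype_fun_eq_card, Fintype.card_fin,
    Module.finrank_self] at h1 h2
  lia

theorem invariants_prod_le_ker (h v : Equiv.Perm (Fin s)) :
    (invariants h).prod (invariants v) ≤ LinearMap.ker (divergence h v) := by
  rintro ⟨l, b⟩ ⟨hl, hb⟩
  refine LinearMap.mem_ker.2 (funext fun j => ?_)
  have hlj : l (h j) = l j := mem_invariants.1 hl j
  have hbj : b (v j) = b j := mem_invariants.1 hb j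
  simp [divergence_apply, hlj, hbj]

theorem finrank_invariants_prod (h v : Equiv.Perm (Fin s)) :
    Module.finrank ℚ ((invariants h).prod (invariants v)) = numCycles h + numCycles v := by
  have hrange : LinearMap.range ((invariants h).subtype.prodMap (invariants v).subtype) =
      (invariants h).prod (invariants v) := by
    rw [LinearMap.range_prodMap, Submodule.range_subtype, Submodule.range_subtype]
  rw [← finrank_invariants, ← finrank_invariants, ← Module.finrank_prod, ← hrange]
  exact LinearMap.finrank_range_of_inj
    (Function.Injective.prodMap (Submodule.injective_subtype _) (Submodule.injective_subtype _))

/-- The integral homology of the dual graph consists of combinations of cylinder classes. -/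
def OnlyCylinderClasses (h v : Equiv.Perm (Fin s)) : Prop :=
  ∀ l b : Fin s → ℤ, (∀ j, l (h j) - l j + (b (v j) - b j) = 0) →
    (∀ j, l (h j) = l j) ∧ ∀ j, b (v j) = b j

/-- The two numbers are the dimensions of the space of cylinder classes and of the kernel containing
it, so they agree exactly when the two spaces coincide. -/
theorem numCycles_add_eq_iff {h v : Equiv.Perm (Fin s)} (hX : IsOrigami h v) :
    numCycles h + numCycles v = s + 1 ↔ OnlyCylinderClasses h v := by
  rw [← finrank_ker_divergence hX, ← finrank_invariants_prod]
  constructor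
  · intro heq l b hlb
    have hker := Submodule.eq_of_le_of_finrank_eq (invariants_prod_le_ker h v) heq
    have hmem : ((fun j => (l j : ℚ)), fun j => (b j : ℚ)) ∈ LinearMap.ker (divergence h v) := by
      refine LinearMap.mem_ker.2 (funext fun j => ?_)
      rw [divergence_apply, Pi.zero_apply]
      exact_mod_cast hlb j
    rw [← hker] at hmem
    exact ⟨fun j => Int.cast_injective (mem_invariants.1 hmem.1 j),
      fun j => Int.cast_injective (mem_invariants.1 hmem.2 j)⟩
  · intro hcyl
    refine congrArg (fun W : Submodule ℚ _ => Module.finrank ℚ W)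
      (le_antisymm (invariants_prod_le_ker h v) ?_)
    rintro ⟨l, b⟩ hlb
    -- A common denominator reduces a rational solution to an integral one.
    obtain ⟨N, hN⟩ := IsLocalization.exist_integer_multiples_of_finite (nonZeroDivisors ℤ)
      (Sum.elim l b)
    have hN0 : ((N : ℤ) : ℚ) ≠ 0 := by exact_mod_cast nonZeroDivisors.coe_ne_zero N
    choose g hg using hN
    have hgl (j) : (g (Sum.inl j) : ℚ) = (N : ℤ) * l j := by simpa using hg (Sum.inl j)
    have hgb (j) : (g (Sum.inr j) : ℚ) = (N : ℤ) * b j := by simpa using hg (Sum.inr j)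
    obtain ⟨h1, h2⟩ := hcyl (fun j => g (Sum.inl j)) (fun j => g (Sum.inr j)) fun j => by
      have hj : l (h j) - l j + (b (v j) - b j) = 0 := congrFun hlb j
      have : ((g (Sum.inl (h j)) - g (Sum.inl j) + (g (Sum.inr (v j)) - g (Sum.inr j)) : ℤ) : ℚ)
          = 0 := by
        push_cast
        rw [hgl, hgl, hgb, hgb]
        linear_combination (N : ℤ) * hj
      exact_mod_cast this
    refine ⟨mem_invariants.2 fun j => mul_left_cancel₀ hN0 ?_,
      mem_invariants.2 fun j => mul_left_cancel₀ hN0 ?_⟩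
    · rw [← hgl, ← hgl, h1]
    · rw [← hgb, ← hgb, h2]

end Origami

/-! ### The homology of the dual graph of the standard triangulation -/

namespace TrivalentRibbonGraph

theorem mem_homology_iff (Γ : TrivalentRibbonGraph) [Fintype Γ.H] [DecidableEq Γ.E]
    [DecidableEq Γ.F] (α : Γ.H →₀ ℤ) :
    α ∈ Γ.homology ↔ (∀ e, ∑ x, (if Γ.ε x = e then α x else 0) = 0) ∧
      ∀ f, ∑ x, (if Γ.φ x = f then α x else 0) = 0 := by
  have hb (y) : Γ.boundary α y = ∑ x, α x * ((Finsupp.single (Sum.inl (Γ.ε x)) 1 -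
      Finsupp.single (Sum.inr (Γ.φ x)) 1 : (Γ.E ⊕ Γ.F) →₀ ℤ) y) := by
    rw [boundary, Finsupp.linearCombination_apply, Finsupp.sum_fintype _ _ (by simp)]
    simp [Finsupp.finsetSum_apply]
  rw [homology, LinearMap.mem_ker, Finsupp.ext_iff, Sum.forall]
  refine and_congr (forall_congr' fun e => ?_) (forall_congr' fun f => ?_)
  · rw [hb]
    simp [Finsupp.single_apply]
  · rw [hb]
    simp [Finsupp.single_apply]

/-- Pushing `α` forward along `ι` gives `α ∘ ι⁻¹`, and this is `-α` if and only if `α ∘ ι = -α`. The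
pulled-back form can be evaluated at individual half-edges. -/
theorem isTriangleMatching_iff (Γ : TrivalentRibbonGraph) [Fintype Γ.H] [DecidableEq Γ.E]
    [DecidableEq Γ.F] (ι : Equiv.Perm Γ.H) :
    Γ.IsTriangleMatching ι ↔ (∀ x, ι (Γ.rot x) = Γ.rot (ι x)) ∧ ∀ α : Γ.H → ℤ,
      (∀ e, ∑ x, (if Γ.ε x = e then α x else 0) = 0) →
      (∀ f, ∑ x, (if Γ.φ x = f then α x else 0) = 0) → ∀ x, α (ι x) = -α x := by
  refine and_congr_right fun _ => ⟨fun hι α he hf x => ?_, fun hι α hα => ?_⟩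
  · have h1 := DFunLike.congr_fun (hι (Finsupp.equivFunOnFinite.symm α)
      ((Γ.mem_homology_iff _).2 ⟨he, hf⟩)) (ι x)
    rw [Finsupp.mapDomain_apply ι.injective] at h1
    have h2 : α x = -α (ι x) := h1
    rw [h2, neg_neg]
  · obtain ⟨he, hf⟩ := (Γ.mem_homology_iff α).1 hα
    ext x
    obtain ⟨x, rfl⟩ := ι.surjective x
    rw [Finsupp.mapDomain_apply ι.injective, Finsupp.neg_apply, hι α he hf, neg_neg]

end TrivalentRibbonGraph

namespace Origami

variable {s : ℕ}

/-- The equations that characterize the 1-cycles of the dual graph of the standard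
triangulation. -/
def IsDualCycle (h v : Equiv.Perm (Fin s)) (α : HalfEdge s → ℤ) : Prop :=
  ∀ j, (α ((j, false), 0) + α ((j, false), 1) + α ((j, false), 2) = 0 ∧
      α ((j, true), 0) + α ((j, true), 1) + α ((j, true), 2) = 0) ∧
    α ((v j, false), 0) + α ((j, true), 1) = 0 ∧
    α ((j, false), 1) + α ((h j, true), 2) = 0 ∧
    α ((j, false), 2) + α ((j, true), 0) = 0

theorem sum_halfEdge (g : HalfEdge s → ℤ) :
    ∑ x, g x = ∑ j, (g ((j, false), 0) + g ((j, false), 1) + g ((j, false), 2) +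
      (g ((j, true), 0) + g ((j, true), 1) + g ((j, true), 2))) := by
  rw [Fintype.sum_prod_type, Fintype.sum_prod_type]
  refine Finset.sum_congr rfl fun j _ => ?_
  rw [Fintype.sum_bool, Fin.sum_univ_three, Fin.sum_univ_three, add_comm]

/-- There is one equation for each face and one for each edge. Since `h` and `v` are bijective, the
labels `(v j, 0)`, `(h j, 1)` and `(j, 2)` run over all edges. -/
theorem isDualCycle_iff (h v : Equiv.Perm (Fin s)) [DecidableEq (Set.range (side h v))]
    (α : HalfEdge s → ℤ) :
    IsDualCycle h v α ↔
      (∀ e : Set.range (side h v), ∑ x : HalfEdge s,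
        (if (⟨side h v x, x, rfl⟩ : Set.range (side h v)) = e then α x else 0) = 0) ∧
      ∀ f : Face s, ∑ x : HalfEdge s, (if x.1 = f then α x else 0) = 0 := by
  have hedge : (∀ e : Set.range (side h v), ∑ x : HalfEdge s,
      (if (⟨side h v x, x, rfl⟩ : Set.range (side h v)) = e then α x else 0) = 0) ↔
      ∀ l : Fin s × Fin 3, ∑ x : HalfEdge s, (if label h v x = l then α x else 0) = 0 := by
    have hlabel (l) : ∃ y, label h v y = l := by
      obtain ⟨y⟩ := (Nat.card_pos_iff.1 (by rw [card_label_fibre h v l]; norm_num)).1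
      exact ⟨y, y.2⟩
    have hsum (y : HalfEdge s) : ∑ x : HalfEdge s,
        (if (⟨side h v x, x, rfl⟩ : Set.range (side h v)) = ⟨side h v y, y, rfl⟩ then α x else 0) =
          ∑ x : HalfEdge s, (if label h v x = label h v y then α x else 0) :=
      Finset.sum_congr rfl fun x _ =>
        if_congr (Subtype.ext_iff.trans (side_eq_iff h v x y)) rfl rfl
    constructor
    · intro he l
      obtain ⟨y, rfl⟩ := hlabel l
      exact (hsum y).symm.trans (he _)
    · rintro hl ⟨_, y, rfl⟩
      exact (hsum y).trans (hl _)
  have hface (j : Fin s) (c : Bool) : ∑ x : HalfEdge s, (if x.1 = (j, c) then α x else 0) =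
      α ((j, c), 0) + α ((j, c), 1) + α ((j, c), 2) := by
    rw [sum_halfEdge]
    cases c <;> simp [Finset.sum_add_distrib]
  have hbottom (j : Fin s) : ∑ x : HalfEdge s, (if label h v x = (v j, 0) then α x else 0) =
      α ((v j, false), 0) + α ((j, true), 1) := by
    rw [sum_halfEdge]
    simp [label, Finset.sum_add_distrib]
  have hright (j : Fin s) : ∑ x : HalfEdge s, (if label h v x = (h j, 1) then α x else 0) =
      α ((j, false), 1) + α ((h j, true), 2) := by
    rw [sum_halfEdge]
    simp [label, Finset.sum_add_distrib]
  have hdiag (j : Fin s) : ∑ x : HalfEdge s, (if label h v x = (j, 2) then α x else 0) =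
      α ((j, false), 2) + α ((j, true), 0) := by
    rw [sum_halfEdge]
    simp [label, Finset.sum_add_distrib]
  rw [hedge]
  constructor
  · refine fun hα => ⟨?_, ?_⟩
    · rintro ⟨j, k⟩
      fin_cases k
      · have := hbottom (v.symm j)
        rw [(hα _).2.1, v.apply_symm_apply] at this
        exact this
      · have := hright (h.symm j)
        rw [(hα _).2.2.1, h.apply_symm_apply] at this
        exact this
      · exact (hdiag j).trans (hα j).2.2.2
    · rintro ⟨j, c⟩
      rw [hface]
      cases c
      · exact (hα j).1.1
      · exact (hα j).1.2
  · rintro ⟨he, hf⟩ j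
    rw [← hface, ← hface, ← hbottom, ← hright, ← hdiag]
    exact ⟨⟨hf _, hf _⟩, he _, he _, he _⟩

theorem isTriangleMatching_iff (h v : Equiv.Perm (Fin s)) (ι : Equiv.Perm (HalfEdge s)) :
    (standardDualGraph h v).IsTriangleMatching ι ↔
      (∀ f i, ι (f, i + 1) = ((ι (f, i)).1, (ι (f, i)).2 + 1)) ∧
      ∀ α, IsDualCycle h v α → ∀ x, α (ι x) = -α x := by
  let : Fintype (standardDualGraph h v).H := inferInstanceAs (Fintype (HalfEdge s))
  let instE : DecidableEq (Set.range (side h v)) := Classical.decEq _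
  let : DecidableEq (standardDualGraph h v).E := instE
  let : DecidableEq (standardDualGraph h v).F := inferInstanceAs (DecidableEq (Face s))
  refine ((standardDualGraph h v).isTriangleMatching_iff ι).trans (and_congr Prod.forall ?_)
  exact forall_congr' fun α => and_imp.symm.trans (imp_congr_left (isDualCycle_iff h v α).symm)

/-! ### Triangle matchings -/

/-- The rotation of every square by a half-turn. -/
def halfTurn (s : ℕ) : Equiv.Perm (HalfEdge s) :=
  Function.Involutive.toPerm
    -- The shifts exchange bottom with top and right with left, and match the two half-edges of the
    -- diagonal.
    (fun x => ((x.1.1, !x.1.2), x.2 + bif x.1.2 then 2 else 1)) (by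
      rintro ⟨⟨j, c⟩, i⟩
      cases c <;> fin_cases i <;> rfl)

theorem OnlyCylinderClasses.admitsTriangleMatching {h v : Equiv.Perm (Fin s)}
    (hcyl : OnlyCylinderClasses h v) : AdmitsTriangleMatching h v := by
  refine ⟨halfTurn s, (isTriangleMatching_iff h v (halfTurn s)).2 ⟨?_, fun α hα => ?_⟩⟩
  · exact fun f i => Prod.ext rfl (add_right_comm _ _ _)
  -- Eliminating the right, top and diagonal coefficients leaves one equation per square in the left
  -- and bottom coefficients. Invariance of these is what negation under exchange of opposite sides
  -- requires.
  · obtain ⟨hl, hb⟩ := hcyl (fun j => α ((j, true), 2)) (fun j => α ((j, false), 0)) fun j => by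
      have := hα j
      lia
    rintro ⟨⟨j, c⟩, i⟩
    have := hα j
    have := hl j
    have := hb j
    cases c <;> fin_cases i
    · change α ((j, true), 1) = -α ((j, false), 0)
      lia
    · change α ((j, true), 2) = -α ((j, false), 1)
      lia
    · change α ((j, true), 0) = -α ((j, false), 2)
      lia
    · change α ((j, false), 2) = -α ((j, true), 0)
      lia
    · change α ((j, false), 0) = -α ((j, true), 1)
      lia
    · change α ((j, false), 1) = -α ((j, true), 2)
      lia

/-- The chain on the dual graph whose coefficients on the left sides and on the bottom sides of the
squares are `l` and `b`. -/
def flow (h v : Equiv.Perm (Fin s)) (l b : Fin s → ℤ) (x : HalfEdge s) : ℤ :=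
  bif x.1.2 then ![b x.1.1 - l (h x.1.1), -b (v x.1.1), l x.1.1] x.2
  else ![b x.1.1, -l (h x.1.1), l (h x.1.1) - b x.1.1] x.2

theorem flow_false (h v : Equiv.Perm (Fin s)) (l b : Fin s → ℤ) (j : Fin s) (i : Fin 3) :
    flow h v l b ((j, false), i) = ![b j, -l (h j), l (h j) - b j] i := rfl

theorem flow_true (h v : Equiv.Perm (Fin s)) (l b : Fin s → ℤ) (j : Fin s) (i : Fin 3) :
    flow h v l b ((j, true), i) = ![b j - l (h j), -b (v j), l j] i := rfl

theorem isDualCycle_flow {h v : Equiv.Perm (Fin s)} {l b : Fin s → ℤ}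
    (hlb : ∀ j, l (h j) - l j + (b (v j) - b j) = 0) : IsDualCycle h v (flow h v l b) := by
  intro j
  have := hlb j
  simp only [flow_false, flow_true, Matrix.cons_val_zero, Matrix.cons_val_one, Matrix.cons_val]
  lia

/-- If a cycle of `h` and a cycle of `v` have at most one square in common, then every triangle
matching rotates the squares by a half-turn, and all homology is generated by cylinders. -/
theorem onlyCylinderClasses_of_isTriangleMatching {h v : Equiv.Perm (Fin s)}
    {ι : Equiv.Perm (HalfEdge s)} (hm : (standardDualGraph h v).IsTriangleMatching ι)
    (hs : ∀ i j, h.SameCycle i j → v.SameCycle i j → i = j) : OnlyCylinderClasses h v := by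
  classical
  obtain ⟨hι, hneg⟩ := (isTriangleMatching_iff h v ι).1 hm
  have hflow (l b : Fin s → ℤ) (hlb : ∀ j, l (h j) - l j + (b (v j) - b j) = 0) :=
    hneg _ (isDualCycle_flow hlb)
  -- The test classes are those of the horizontal and of the vertical cylinder through `j`. On the
  -- bottom of `j` they take the values `0` and `1`, and on the next side the horizontal class takes
  -- the value `-1`; the matching negates these three values.
  have key (j : Fin s) : ι ((j, false), 0) = ((j, true), 1) := by
    let χ : Fin s → ℤ := fun k => if h.SameCycle j k then 1 else 0
    let ω : Fin s → ℤ := fun k => if v.SameCycle j k then 1 else 0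
    have hχ (k) : χ (h k) = χ k := by simp only [χ, Equiv.Perm.sameCycle_apply_right]
    have hω (k) : ω (v k) = ω k := by simp only [ω, Equiv.Perm.sameCycle_apply_right]
    have hχj : χ j = 1 := if_pos (.refl h j)
    have hωj : ω j = 1 := if_pos (.refl v j)
    have hω0 (k) : 0 ≤ ω k := by
      simp only [ω]
      split_ifs <;> norm_num
    have f1 := hflow χ 0 (fun k => by simp [hχ])
    have f2 := hflow 0 ω (fun k => by simp [hω])
    have a0 := f1 ((j, false), 0)
    have a1 := f1 ((j, false), 0 + 1)
    have b0 := f2 ((j, false), 0)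
    rw [hι] at a1
    obtain ⟨⟨⟨k, c⟩, i⟩, hx⟩ : ∃ x, x = ι ((j, false), 0) := ⟨_, rfl⟩
    rw [← hx] at a0 a1 b0 ⊢
    -- As `ω` is nonnegative, the vertical class can be `-1` only at a top side or at the diagonal
    -- of a lower triangle. The latter is followed by a bottom side, where the horizontal class is
    -- `0` instead of `1`. So the image is the top of a square `k`, and the nonzero values put `k`
    -- in both cycles through `j`.
    have hk := hω0 k
    cases c <;> fin_cases i <;>
      simp [flow_false, flow_true, hχ, hω, hχj, hωj] at a0 a1 b0 ⊢ <;> try lia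
    refine (hs j k ?_ ?_).symm
    · by_contra hc
      simp [χ, hc] at a1
    · by_contra hc
      simp [ω, hc] at b0
  intro l b hlb
  have f := hflow l b hlb
  -- Compatibility with rotation carries the right side of `j` to its left side, which gives the
  -- invariance of `l`; bottom to top gives that of `b`.
  refine ⟨fun j => ?_, fun j => ?_⟩
  · have := f ((j, false), 0 + 1)
    rw [hι, key, flow_true, flow_false] at this
    simpa [eq_comm] using this
  · have := f ((j, false), 0)
    rw [key, flow_true, flow_false] at this
    simpa using this

end Origami

theorem theorem6p16 (s : ℕ) (h v : Equiv.Perm (Fin s)) (hX : Origami.IsOrigami h v)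
    (hsimple : Origami.IsGeometricallySimple h v) :
    [Origami.IsArboreal h v,
      Origami.AdmitsTriangleMatching h v,
      Origami.numCycles h + Origami.numCycles v = s + 1].TFAE := by
  have hs (i j) (hh : h.SameCycle i j) (hv : v.SameCycle i j) : i = j :=
    hsimple.eq_of_sameCycle hh hv
  tfae_have 1 ↔ 3 := Origami.isArboreal_iff hX hs
  tfae_have 2 → 3 := fun ⟨_, hm⟩ => (Origami.numCycles_add_eq_iff hX).2
    (Origami.onlyCylinderClasses_of_isTriangleMatching hm hs)
  tfae_have 3 → 2 := fun hc =>
    ((Origami.numCycles_add_eq_iff hX).1 hc).admitsTriangleMatching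
  tfae_finish
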